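/- A convex body in $\mathbb{R}^n$ is a compact convex set with non-empty interior. For a convex body $K\subset\mathbb{R}^n$ let $\chi_K$ be its characteristic function and $\widehat{\chi_K}(y)=\int_K e^{-i\langle x,y\rangle}\,dx$ its Fourier transform. For $p>0$, the Fourier $p$th mean body $F_pK$ of $K$ is the star-shaped set with radial function $$\rho_{F_pK}(\theta)=\left(\frac{p}{\mathrm{Vol}_n(K)}\int_0^{\infty}|\widehat{\chi_K}(r\theta)|^2\,r^{p-1}\,dr\right)^{1/p}\in[0,\infty],\qquad \theta\in\mathbb{S}^{n-1},$$ that is, $F_pK=\{o\}\cup\{x\in\mathbb{R}^n\setminus\{o\}: |x|\le \rho_{F_pK}(x/|x|)\}$. Theorem. Let $K\subset\mathbb{R}^n$ be a convex body and let $p\in(0,1]$. Then $F_pK$ is an origin-symmetric convex body; that is, $F_pK$ is compact and convex, has non-empty interior, and satisfies $F_pK=-F_pK$. -/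

import Mathlib

open MeasureTheory Set
open scoped ENNReal

noncomputable section

/-- A convex body in `ℝⁿ`: a compact convex set with non-empty interior. -/
structure IsConvexBody {n : ℕ} (K : Set (EuclideanSpace ℝ (Fin n))) : Prop where
  convex : Convex ℝ K
  isCompact : IsCompact K
  nonempty_interior : (interior K).Nonempty

/-- A set `M` is origin-symmetric if `M = -M`. -/
def IsOriginSymmetric {n : ℕ} (M : Set (EuclideanSpace ℝ (Fin n))) : Prop :=
  M = {x | -x ∈ M}

/-- A star-shaped set contains the origin and, with each point, the segment from the origin. -/
def IsStarShaped {n : ℕ} (M : Set (EuclideanSpace ℝ (Fin n))) : Prop :=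
  0 ∈ M ∧ ∀ x ∈ M, segment ℝ 0 x ⊆ M

/-- The Fourier transform `f̂(y) = ∫ e^{-i⟨x, y⟩} f(x) dx` (no factor `2π`). -/
def fourierTransform {n : ℕ} (f : EuclideanSpace ℝ (Fin n) → ℂ)
    (y : EuclideanSpace ℝ (Fin n)) : ℂ :=
  ∫ x, Complex.exp (-Complex.I * ((inner ℝ x y : ℝ) : ℂ)) * f x

/-- The characteristic function `χ_K`. -/
def charIndicator {n : ℕ} (K : Set (EuclideanSpace ℝ (Fin n))) :
    EuclideanSpace ℝ (Fin n) → ℂ :=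
  K.indicator (fun _ => 1)

/-- The radial function `ρ_M(θ) = sup {t > 0 : tθ ∈ M}`, with values in `[0, ∞]`. -/
def radialFunction {n : ℕ} (M : Set (EuclideanSpace ℝ (Fin n)))
    (θ : EuclideanSpace ℝ (Fin n)) : ℝ≥0∞ :=
  ⨆ (t : ℝ) (_ : 0 < t ∧ t • θ ∈ M), ENNReal.ofReal t

/-- The star-shaped set given by prescribing its radial function `ρ` on the unit sphere:
the origin, and all `x ≠ 0` with `|x| ≤ ρ(x / |x|)`. -/
def starSet {n : ℕ} (ρ : EuclideanSpace ℝ (Fin n) → ℝ≥0∞) :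
    Set (EuclideanSpace ℝ (Fin n)) :=
  {x | x ≠ 0 → ENNReal.ofReal ‖x‖ ≤ ρ (‖x‖⁻¹ • x)}

/-- `(p / Vol(K) · ∫₀^∞ |χ̂_K(rθ)|² r^{p-1} dr)^{1/p}`, with values in `[0, ∞]`: the radial
function of the Fourier `p`th mean body of `K`, for unit vectors `θ`. -/
def fourierMeanRadial {n : ℕ} (p : ℝ) (K : Set (EuclideanSpace ℝ (Fin n)))
    (θ : EuclideanSpace ℝ (Fin n)) : ℝ≥0∞ :=
  (ENNReal.ofReal p / volume K *
    ∫⁻ r in Ioi (0 : ℝ),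
      ENNReal.ofReal (‖fourierTransform (charIndicator K) (r • θ)‖ ^ 2 * r ^ (p - 1))) ^ (1 / p)

/-- The Fourier `p`th mean body `F_p K`. -/
def fourierMeanBody {n : ℕ} (p : ℝ) (K : Set (EuclideanSpace ℝ (Fin n))) :
    Set (EuclideanSpace ℝ (Fin n)) :=
  starSet (fourierMeanRadial p K)

/-- `starSet ρ` is star-shaped. -/
theorem isStarShaped_starSet {n : ℕ} (ρ : EuclideanSpace ℝ (Fin n) → ℝ≥0∞) :
    IsStarShaped (starSet ρ) := by
  refine ⟨fun h => absurd rfl h, ?_⟩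
  rintro x hx y ⟨a, b, ha, hb, hab, rfl⟩ hy
  rw [smul_zero, zero_add] at hy ⊢
  have hb0 : 0 < b := lt_of_le_of_ne hb (fun h => hy (by rw [← h, zero_smul]))
  have hx0 : x ≠ 0 := fun h => hy (by rw [h, smul_zero])
  have hn : ‖b • x‖ = b * ‖x‖ := by rw [norm_smul, Real.norm_of_nonneg hb]
  have hd : ‖b • x‖⁻¹ • b • x = ‖x‖⁻¹ • x := by
    rw [hn, smul_smul, mul_inv, mul_right_comm, inv_mul_cancel₀ hb0.ne', one_mul]
  rw [hd]
  refine le_trans (ENNReal.ofReal_le_ofReal ?_) (hx hx0)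
  rw [hn]
  exact mul_le_of_le_one_left (norm_nonneg x) (by linarith)

/-- `starSet ρ` has radial function `ρ` on the unit sphere. -/
theorem radialFunction_starSet {n : ℕ} (ρ : EuclideanSpace ℝ (Fin n) → ℝ≥0∞)
    (θ : EuclideanSpace ℝ (Fin n)) (hθ : ‖θ‖ = 1) :
    radialFunction (starSet ρ) θ = ρ θ := by
  have key : ∀ t : ℝ, 0 < t → (t • θ ∈ starSet ρ ↔ ENNReal.ofReal t ≤ ρ θ) := by
    intro t ht
    have hn : ‖t • θ‖ = t := by rw [norm_smul, Real.norm_of_nonneg ht.le, hθ, mul_one]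
    have h0 : t • θ ≠ 0 := by
      rw [← norm_pos_iff, hn]; exact ht
    have hd : ‖t • θ‖⁻¹ • t • θ = θ := by
      rw [hn, smul_smul, inv_mul_cancel₀ ht.ne', one_smul]
    simp only [starSet, mem_ofPred_eq]
    rw [hd, hn]
    exact ⟨fun h => h h0, fun h _ => h⟩
  apply le_antisymm
  · refine iSup₂_le fun t ht => (key t ht.1).1 ht.2
  · refine ENNReal.le_of_forall_nnreal_lt fun r hr => ?_
    rcases eq_or_ne r 0 with rfl | hr0
    · simp
    · have hpos : (0 : ℝ) < r := by exact_mod_cast pos_iff_ne_zero.2 hr0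
      have hmem : (r : ℝ) • θ ∈ starSet ρ := (key r hpos).2 (by simpa using hr.le)
      have h := le_iSup₂ (f := fun (t : ℝ) (_ : 0 < t ∧ t • θ ∈ starSet ρ) => ENNReal.ofReal t)
        (r : ℝ) ⟨hpos, hmem⟩
      rw [ENNReal.ofReal_coe_nnreal] at h
      exact h

end

/-!
Write `g_K` for the autocorrelation of `χ_K`, so that `|χ̂_K|²` is the Fourier transform of `g_K`.
For `0 < p < 1` the Fourier transform of `r^(p-1)` is a multiple of `|u|^(-p)`, so

  `M(a) = ∫₀^∞ |χ̂_K(ra)|² r^(p-1) dr = c ∫ g_K(x) |⟨x, a⟩|^(-p) dx`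

(`exists_fourierMoment_eq`, proved with Tonelli's theorem from the Laplace transform of
`r ↦ |χ̂_K(ra)|²`). Since `F_pK` is a sublevel set of `Ψ = M^(-1/p)`, which is even and positively
homogeneous, it has to be shown that `Ψ` is a norm, and only the triangle inequality is at stake.

That inequality concerns two vectors, so `g_K` may be replaced by its marginal `g` on a plane, which
is even and, by the Prékopa–Leindler inequality, log-concave. In a projective coordinate `w` on the
plane, `M` restricted to an affine line is the convolution of `|w|^(-p)` with `k = W^(-(2-p))`,
where `W(x) = (∫₀^∞ t^(1-p) g(tx) dt)^(-1/(2-p))` is a norm by Ball's theorem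
(`LogConcave.le_radialMoment`). Given `a`, choose the coordinate along a supporting line of the unit
ball of `W` at its boundary point orthogonal to `a`: then `k` is unimodal about the point that
corresponds to `a` (`exists_line_radialMoment_unimodal`), and a rearrangement argument gives
`M(a + hb') + M(a - hb') ≤ 2 M(a)` for all `h`, where `b'` is a direction adapted to `a`
(`lintegral_unimodal_le`). Hence `2 Ψ(a) ≤ Ψ(a + hb') + Ψ(a - hb')`. Although `b'` depends on `a`,
this suffices for an upper semicontinuous homogeneous function to be subadditive
(`add_le_of_local_midpoint`).

The case `p = 1` follows by letting `p` increase to `1`. Finiteness of `M` away from the origin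
comes from the case `p = 1`, where the Laplace transform formula and an average over translations
of `K` along `a` bound `∫₀^∞ |χ̂_K(ra)|² dr`.
-/

noncomputable section

/-! ### One-dimensional inequalities from Brunn–Minkowski -/

open scoped Pointwise in
/-- Only outer measure is used for the sumset, which need not be measurable. -/
theorem volume_add_volume_le_of_isCompact {A B : Set ℝ} (hA : IsCompact A) (hB : IsCompact B)
    (hA0 : A.Nonempty) (hB0 : B.Nonempty) : volume A + volume B ≤ volume (A + B) := by
  set a := sSup A
  set b := sInf B
  have ha : a ∈ A := hA.sSup_mem hA0
  have hb : b ∈ B := hB.sInf_mem hB0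
  have h1 : (fun x => x + b) '' A ∪ (fun x => a + x) '' B ⊆ A + B := by
    rintro _ (⟨x, hx, rfl⟩ | ⟨x, hx, rfl⟩)
    · exact add_mem_add hx hb
    · exact add_mem_add ha hx
  have h2 : volume ((fun x => x + b) '' A ∩ (fun x => a + x) '' B) = 0 := by
    refine measure_mono_null (t := {a + b}) ?_ (by simp)
    rintro _ ⟨⟨x, hx, rfl⟩, ⟨y, hy, hxy⟩⟩
    have hxa : x ≤ a := le_csSup hA.bddAbove hx
    have hyb : b ≤ y := csInf_le hB.bddBelow hy
    simp only at hxy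
    simp only [mem_singleton_iff]
    linarith
  have h3 : MeasurableSet ((fun x => a + x) '' B) :=
    (hB.image (by fun_prop)).measurableSet
  have h4 := measure_union_add_inter (μ := volume) ((fun x => x + b) '' A) h3
  rw [h2, add_zero] at h4
  refine le_trans (le_of_eq ?_) (measure_mono h1)
  rw [h4]
  congr 1 <;> simp

open scoped Pointwise in
/-- The Brunn–Minkowski inequality on the line. -/
theorem volume_add_volume_le {A B : Set ℝ} (hA : MeasurableSet A) (hB : MeasurableSet B)
    (hA0 : A.Nonempty) (hB0 : B.Nonempty) : volume A + volume B ≤ volume (A + B) := by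
  obtain ⟨a, ha⟩ := hA0
  obtain ⟨b, hb⟩ := hB0
  rw [hA.measure_eq_iSup_isCompact, hB.measure_eq_iSup_isCompact]
  simp only [iSup_and']
  refine ENNReal.biSup_add_biSup_le' ⟨∅, by simp⟩ ⟨∅, by simp⟩ ?_
  rintro K ⟨hKA, hK⟩ K' ⟨hKB, hK'⟩
  calc volume K + volume K' ≤ volume (insert a K) + volume (insert b K') := by
        gcongr <;> exact subset_insert _ _
    _ ≤ volume (insert a K + insert b K') :=
        volume_add_volume_le_of_isCompact (hK.insert a) (hK'.insert b) (by simp) (by simp)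
    _ ≤ volume (A + B) :=
        measure_mono (add_subset_add (insert_subset ha hKA) (insert_subset hb hKB))

/-- Layer-cake formula for a function with values in `[0, 1]`. -/
theorem lintegral_min_one_eq {f : ℝ → ℝ≥0∞} (hf : Measurable f) :
    ∫⁻ x, min (f x) 1 = ∫⁻ t in Ioo (0 : ℝ) 1, volume {x | ENNReal.ofReal t < f x} := by
  have h1 : ∀ x, min (f x) 1 = ENNReal.ofReal (min (f x) 1).toReal := fun x =>
    (ENNReal.ofReal_toReal (ne_top_of_le_ne_top ENNReal.one_ne_top (min_le_right _ _))).symm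
  rw [lintegral_congr h1, lintegral_eq_lintegral_meas_lt volume
    (Filter.Eventually.of_forall fun x => by positivity) (by fun_prop)]
  have h3 : ∀ t, 0 < t → {x | t < (min (f x) 1).toReal} =
      {x | ENNReal.ofReal t < f x ∧ t < 1} := by
    intro t ht
    ext x
    simp only [mem_ofPred_eq]
    rw [← ENNReal.ofReal_lt_iff_lt_toReal ht.le
      (ne_top_of_le_ne_top ENNReal.one_ne_top (min_le_right _ _)), lt_min_iff,
      ENNReal.ofReal_lt_one]
  rw [← Ioo_union_Ici_eq_Ioi (zero_lt_one' ℝ),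
    lintegral_union measurableSet_Ici (by
      rw [Set.disjoint_left]; intro x hx hx'; exact absurd hx.2 (not_lt.2 hx'))]
  have h4 : ∫⁻ t in Ici (1 : ℝ), volume {x | t < (min (f x) 1).toReal} = 0 := by
    rw [setLIntegral_congr_fun (g := fun _ => 0) measurableSet_Ici]
    · simp
    · intro t ht
      simp only
      rw [h3 t (lt_of_lt_of_le one_pos ht)]
      simp [not_lt.2 (mem_Ici.1 ht)]
  rw [h4, add_zero]
  refine setLIntegral_congr_fun measurableSet_Ioo fun t ht => ?_
  rw [h3 t ht.1]
  simp [ht.2]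

open scoped Pointwise in
/-- Functional form of the Brunn–Minkowski inequality on the line, for functions with the same
supremum. -/
theorem lintegral_add_le_of_min_le {f g h : ℝ → ℝ≥0∞} (hf : Measurable f) (hg : Measurable g)
    (hh : Measurable h) (hf1 : ⨆ x, f x = 1) (hg1 : ⨆ x, g x = 1) {a b : ℝ} (ha : 0 < a)
    (hb : 0 < b) (H : ∀ x y, min (f x) (g y) ≤ h (a * x + b * y)) :
    ENNReal.ofReal a * (∫⁻ x, f x) + ENNReal.ofReal b * (∫⁻ x, g x) ≤ ∫⁻ x, h x := by
  have e : ∀ u : ℝ → ℝ≥0∞, ⨆ x, u x = 1 → ∀ x, u x = min (u x) 1 := fun u hu x =>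
    (min_eq_left (hu ▸ le_iSup u x)).symm
  rw [lintegral_congr (e f hf1), lintegral_congr (e g hg1), lintegral_min_one_eq hf,
    lintegral_min_one_eq hg]
  refine le_trans ?_ (lintegral_mono fun x => min_le_left (h x) 1)
  rw [lintegral_min_one_eq hh, ← lintegral_const_mul' _ _ ENNReal.ofReal_ne_top,
    ← lintegral_const_mul' _ _ ENNReal.ofReal_ne_top]
  have hm : Measurable fun t : ℝ => ENNReal.ofReal a * volume {x | ENNReal.ofReal t < f x} := by
    apply Measurable.const_mul
    apply Antitone.measurable
    intro s t hst
    exact measure_mono fun x hx => lt_of_le_of_lt (ENNReal.ofReal_le_ofReal hst) hx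
  rw [← lintegral_add_left hm]
  refine setLIntegral_mono' measurableSet_Ioo fun t ht => ?_
  have ht1 : ENNReal.ofReal t < 1 := ENNReal.ofReal_lt_one.2 ht.2
  obtain ⟨x0, hx0⟩ := lt_iSup_iff.1 (hf1 ▸ ht1)
  obtain ⟨y0, hy0⟩ := lt_iSup_iff.1 (hg1 ▸ ht1)
  set A := {x | ENNReal.ofReal t < f x}
  set B := {x | ENNReal.ofReal t < g x}
  have hA : MeasurableSet A := measurableSet_lt measurable_const hf
  have hB : MeasurableSet B := measurableSet_lt measurable_const hg
  have e1 : ENNReal.ofReal a * volume A = volume (a • A) := by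
    rw [Measure.addHaar_smul]; simp [abs_of_pos ha]
  have e2 : ENNReal.ofReal b * volume B = volume (b • B) := by
    rw [Measure.addHaar_smul]; simp [abs_of_pos hb]
  rw [e1, e2]
  refine (volume_add_volume_le (hA.const_smul₀ a) (hB.const_smul₀ b)
    (Set.Nonempty.smul_set ⟨x0, hx0⟩) (Set.Nonempty.smul_set ⟨y0, hy0⟩)).trans (measure_mono ?_)
  rintro _ ⟨_, ⟨x, hx, rfl⟩, _, ⟨y, hy, rfl⟩, rfl⟩
  exact lt_of_lt_of_le (lt_min hx hy) (H x y)

/-- The one-dimensional inequality from which the Prékopa–Leindler and Borell–Brascamp–Lieb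
inequalities follow: superlevel sets relative to the suprema `F`, `G` are added by
Brunn–Minkowski. -/
theorem lintegral_div_iSup_add_le {f g h : ℝ → ℝ≥0∞} (hf : Measurable f) (hg : Measurable g)
    (hh : Measurable h) {F G c : ℝ≥0∞} (hF : ⨆ x, f x = F) (hG : ⨆ x, g x = G) (hF0 : F ≠ 0)
    (hFt : F ≠ ⊤) (hG0 : G ≠ 0) (hGt : G ≠ ⊤) (hc0 : c ≠ 0) (hct : c ≠ ⊤) {a b : ℝ} (ha : 0 < a)
    (hb : 0 < b)
    (H : ∀ x y m, m * F ≤ f x → m * G ≤ g y → m * c ≤ h (a * x + b * y)) :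
    c * (ENNReal.ofReal a * (∫⁻ x, f x) / F + ENNReal.ofReal b * (∫⁻ x, g x) / G)
      ≤ ∫⁻ x, h x := by
  have h1 := lintegral_add_le_of_min_le (hf.mul_const F⁻¹) (hg.mul_const G⁻¹) (hh.mul_const c⁻¹)
    (by rw [← ENNReal.iSup_mul, hF, ENNReal.mul_inv_cancel hF0 hFt])
    (by rw [← ENNReal.iSup_mul, hG, ENNReal.mul_inv_cancel hG0 hGt]) ha hb (by
      intro x y
      rw [← div_eq_mul_inv, ← div_eq_mul_inv, ← div_eq_mul_inv,
        ENNReal.le_div_iff_mul_le (.inl hc0) (.inl hct)]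
      refine H x y _ ?_ ?_
      · rw [← ENNReal.le_div_iff_mul_le (.inl hF0) (.inl hFt)]; exact min_le_left _ _
      · rw [← ENNReal.le_div_iff_mul_le (.inl hG0) (.inl hGt)]; exact min_le_right _ _)
  rw [lintegral_mul_const _ hf, lintegral_mul_const _ hg, lintegral_mul_const _ hh,
    ← div_eq_mul_inv (∫⁻ x, h x), ENNReal.le_div_iff_mul_le (.inl hc0) (.inl hct)] at h1
  rw [mul_comm, div_eq_mul_inv, div_eq_mul_inv, mul_assoc, mul_assoc]
  exact h1

/-! ### The Prékopa–Leindler inequality -/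

/-- The measure `ν` satisfies the Prékopa–Leindler inequality. -/
def PrekopaLeindler {E : Type*} [AddCommGroup E] [Module ℝ E] [MeasurableSpace E]
    (ν : Measure E) : Prop :=
  ∀ ⦃a b : ℝ⦄, 0 < a → 0 < b → a + b = 1 → ∀ ⦃f g h : E → ℝ≥0∞⦄, Measurable f → Measurable g →
    Measurable h → (∀ x y, f x ^ a * g y ^ b ≤ h (a • x + b • y)) →
    (∫⁻ x, f x ∂ν) ^ a * (∫⁻ x, g x ∂ν) ^ b ≤ ∫⁻ x, h x ∂ν

theorem ENNReal.geom_mean_le_arith_mean {a b : ℝ} (ha : 0 < a) (hb : 0 < b) (hab : a + b = 1)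
    (x y : ℝ≥0∞) : x ^ a * y ^ b ≤ ENNReal.ofReal a * x + ENNReal.ofReal b * y := by
  have ha' : ENNReal.ofReal a ≠ 0 := by simpa using ha
  have hb' : ENNReal.ofReal b ≠ 0 := by simpa using hb
  rcases eq_or_ne x ⊤ with rfl | hx
  · simp [ENNReal.mul_top, ha']
  rcases eq_or_ne y ⊤ with rfl | hy
  · simp [ENNReal.mul_top, hb']
  lift x to NNReal using hx
  lift y to NNReal using hy
  rw [← ENNReal.coe_rpow_of_nonneg _ ha.le, ← ENNReal.coe_rpow_of_nonneg _ hb.le]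
  lift a to NNReal using ha.le
  lift b to NNReal using hb.le
  rw [ENNReal.ofReal_coe_nnreal, ENNReal.ofReal_coe_nnreal]
  have := NNReal.geom_mean_le_arith_mean2_weighted a b x y (by exact_mod_cast hab)
  exact_mod_cast this

theorem lintegral_rpow_mul_rpow_le_of_bounded {f g h : ℝ → ℝ≥0∞} (hf : Measurable f)
    (hg : Measurable g) (hh : Measurable h) {a b : ℝ} (ha : 0 < a) (hb : 0 < b) (hab : a + b = 1)
    (hft : ⨆ x, f x ≠ ⊤) (hgt : ⨆ x, g x ≠ ⊤)
    (H : ∀ x y, f x ^ a * g y ^ b ≤ h (a * x + b * y)) :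
    (∫⁻ x, f x) ^ a * (∫⁻ x, g x) ^ b ≤ ∫⁻ x, h x := by
  set F := ⨆ x, f x with hF
  set G := ⨆ x, g x with hG
  rcases eq_or_ne F 0 with hF0 | hF0
  · have : ∀ x, f x = 0 := fun x => le_antisymm (hF0 ▸ le_iSup f x) bot_le
    simp [this, ha]
  rcases eq_or_ne G 0 with hG0 | hG0
  · have : ∀ x, g x = 0 := fun x => le_antisymm (hG0 ▸ le_iSup g x) bot_le
    simp [this, hb]
  have key := lintegral_div_iSup_add_le (c := F ^ a * G ^ b) hf hg hh hF.symm hG.symm hF0 hft hG0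
    hgt (by simp [hF0, hG0, hft, hgt]) (by
      refine ENNReal.mul_ne_top ?_ ?_
      · exact ENNReal.rpow_ne_top_of_nonneg ha.le hft
      · exact ENNReal.rpow_ne_top_of_nonneg hb.le hgt) ha hb (by
      intro x y m hx hy
      refine le_trans (le_of_eq ?_) (le_trans (mul_le_mul' (ENNReal.rpow_le_rpow hx ha.le)
        (ENNReal.rpow_le_rpow hy hb.le)) (H x y))
      rw [ENNReal.mul_rpow_of_nonneg _ _ ha.le, ENNReal.mul_rpow_of_nonneg _ _ hb.le,
        mul_mul_mul_comm, ← ENNReal.rpow_add_of_nonneg _ _ ha.le hb.le, hab, ENNReal.rpow_one])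
  refine le_trans ?_ key
  rw [mul_div_assoc, mul_div_assoc]
  refine le_trans (le_of_eq ?_) (mul_le_mul_right
    (ENNReal.geom_mean_le_arith_mean ha hb hab ((∫⁻ x, f x) / F) ((∫⁻ x, g x) / G)) _)
  rw [mul_mul_mul_comm, ← ENNReal.mul_rpow_of_nonneg _ _ ha.le,
    ← ENNReal.mul_rpow_of_nonneg _ _ hb.le, ENNReal.mul_div_cancel hF0 hft,
    ENNReal.mul_div_cancel hG0 hgt]

theorem prekopaLeindler_real : PrekopaLeindler (volume : Measure ℝ) := by
  intro a b ha hb hab f g h hf hg hh H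
  rcases eq_or_ne (∫⁻ x, f x) 0 with hf0 | hf0
  · simp [hf0, ha]
  rcases eq_or_ne (∫⁻ x, g x) 0 with hg0 | hg0
  · simp [hg0, hb]
  have lim : ∀ u : ℝ → ℝ≥0∞, Measurable u → Filter.Tendsto
      (fun n : ℕ => ∫⁻ x, min (u x) n) Filter.atTop (nhds (∫⁻ x, u x)) := by
    intro u hu
    refine lintegral_tendsto_of_tendsto_of_monotone (fun n => by fun_prop) ?_ ?_
    · refine Filter.Eventually.of_forall fun x n m hnm => ?_
      exact min_le_min_left _ (by exact_mod_cast hnm)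
    · refine Filter.Eventually.of_forall fun x => ?_
      have := (tendsto_const_nhds (x := u x)).min ENNReal.tendsto_nat_nhds_top
      simpa using this
  have hlim := ENNReal.Tendsto.mul ((lim f hf).ennrpow_const a) (.inl (by simp [hf0, ha.le]))
    ((lim g hg).ennrpow_const b) (.inl (by simp [hg0, hb.le]))
  refine le_of_tendsto' hlim fun n => ?_
  have bd : ∀ u : ℝ → ℝ≥0∞, ⨆ x, min (u x) (n : ℝ≥0∞) ≠ ⊤ := fun u =>
    ne_top_of_le_ne_top (ENNReal.natCast_ne_top n) (iSup_le fun x => min_le_right _ _)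
  refine lintegral_rpow_mul_rpow_le_of_bounded (by fun_prop) (by fun_prop) hh ha hb hab (bd f)
    (bd g) fun x y => le_trans ?_ (H x y)
  gcongr <;> exact min_le_left _ _

theorem PrekopaLeindler.prod {E F : Type*} [AddCommGroup E] [Module ℝ E] [MeasurableSpace E]
    [AddCommGroup F] [Module ℝ F] [MeasurableSpace F] {ν : Measure E} {ρ : Measure F}
    [SFinite ν] [SFinite ρ] (hν : PrekopaLeindler ν) (hρ : PrekopaLeindler ρ) :
    PrekopaLeindler (ν.prod ρ) := by
  intro a b ha hb hab f g h hf hg hh H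
  rw [lintegral_prod _ hf.aemeasurable, lintegral_prod _ hg.aemeasurable,
    lintegral_prod _ hh.aemeasurable]
  refine hν ha hb hab hf.lintegral_prod_right' hg.lintegral_prod_right' hh.lintegral_prod_right'
    fun s t => ?_
  exact hρ ha hb hab (by fun_prop) (by fun_prop) (by fun_prop) fun x y => H (s, x) (t, y)

theorem PrekopaLeindler.of_linearMap {E F : Type*} [AddCommGroup E] [Module ℝ E]
    [MeasurableSpace E] [AddCommGroup F] [Module ℝ F] [MeasurableSpace F] {ν : Measure E}
    {ρ : Measure F} (hν : PrekopaLeindler ν) (T : E →ₗ[ℝ] F) (hT : MeasurePreserving T ν ρ) :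
    PrekopaLeindler ρ := by
  intro a b ha hb hab f g h hf hg hh H
  rw [← hT.lintegral_comp hf, ← hT.lintegral_comp hg, ← hT.lintegral_comp hh]
  refine hν ha hb hab (hf.comp hT.measurable) (hg.comp hT.measurable) (hh.comp hT.measurable)
    fun x y => ?_
  simpa using H (T x) (T y)

theorem prekopaLeindler_pi (m : ℕ) : PrekopaLeindler (volume : Measure (Fin m → ℝ)) := by
  induction m with
  | zero =>
    intro a b ha hb hab f g h hf hg hh H
    have := H 0 0
    simpa [Measure.volume_pi_eq_dirac 0, lintegral_dirac] using this
  | succ m ih =>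
    let T : ℝ × (Fin m → ℝ) →ₗ[ℝ] (Fin (m + 1) → ℝ) :=
      (Fin.consLinearEquiv ℝ (fun _ : Fin (m + 1) => ℝ)).toLinearMap
    refine PrekopaLeindler.of_linearMap (prekopaLeindler_real.prod ih) T ?_
    have := (volume_preserving_piFinSuccAbove (fun _ : Fin (m + 1) => ℝ) 0).symm
    have hT : ⇑T = ⇑(MeasurableEquiv.piFinSuccAbove (fun _ : Fin (m + 1) => ℝ) 0).symm := by
      funext x
      simp [T, MeasurableEquiv.piFinSuccAbove, Fin.consLinearEquiv]
    rw [hT]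
    exact this

/-! ### Log-concave functions and Ball's theorem -/

/-- A log-concave function with values in `[0, ∞]`. -/
def LogConcave {E : Type*} [AddCommGroup E] [Module ℝ E] (g : E → ℝ≥0∞) : Prop :=
  ∀ ⦃a b : ℝ⦄, 0 < a → 0 < b → a + b = 1 → ∀ x y, g x ^ a * g y ^ b ≤ g (a • x + b • y)

/-- The moment `∫₀^∞ t^(q-1) g(tx) dt` of order `q` of `g` along the ray through `x`. -/
def radialMoment {E : Type*} [AddCommGroup E] [Module ℝ E] (q : ℝ) (g : E → ℝ≥0∞) (x : E) :
    ℝ≥0∞ :=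
  ∫⁻ t in Ioi (0 : ℝ), ENNReal.ofReal (t ^ (q - 1)) * g (t • x)

theorem radialMoment_eq_lintegral_inv {E : Type*} [AddCommGroup E] [Module ℝ E] (q : ℝ)
    (g : E → ℝ≥0∞) (x : E) :
    radialMoment q g x =
      ∫⁻ r in Ioi (0 : ℝ), ENNReal.ofReal (r ^ (-(q + 1))) * g (r⁻¹ • x) := by
  have himg : (fun r : ℝ => r⁻¹) '' Ioi 0 = Ioi 0 := by
    ext r
    constructor
    · rintro ⟨s, hs, rfl⟩
      exact inv_pos.2 (mem_Ioi.1 hs)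
    · exact fun hr => ⟨r⁻¹, inv_pos.2 (mem_Ioi.1 hr), inv_inv r⟩
  have key := lintegral_image_eq_lintegral_abs_deriv_mul (s := Ioi (0 : ℝ))
    (f := fun r : ℝ => r⁻¹) (f' := fun r => -(r ^ 2)⁻¹) measurableSet_Ioi
    (fun r hr => (hasDerivAt_inv (ne_of_gt (mem_Ioi.1 hr))).hasDerivWithinAt)
    (fun r _ s _ h => inv_injective h)
    (fun t => ENNReal.ofReal (t ^ (q - 1)) * g (t • x))
  rw [himg] at key
  rw [radialMoment, key]
  refine setLIntegral_congr_fun measurableSet_Ioi fun r hr => ?_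
  have hr : 0 < r := hr
  rw [← mul_assoc, ← ENNReal.ofReal_mul (abs_nonneg _)]
  congr 2
  rw [abs_neg, abs_of_pos (by positivity), Real.inv_rpow hr.le, ← Real.rpow_neg hr.le,
    ← Real.rpow_natCast, ← Real.rpow_neg hr.le, ← Real.rpow_add hr]
  congr 1
  push_cast
  ring

theorem radialMoment_smul {E : Type*} [AddCommGroup E] [Module ℝ E] (q : ℝ)
    (g : E → ℝ≥0∞) (x : E) {c : ℝ} (hc : 0 < c) :
    radialMoment q g (c • x) = ENNReal.ofReal (c ^ (-q)) * radialMoment q g x := by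
  have himg : (fun r : ℝ => c * r) '' Ioi 0 = Ioi 0 := by
    ext r
    constructor
    · rintro ⟨s, hs, rfl⟩
      exact mul_pos hc (mem_Ioi.1 hs)
    · exact fun hr => ⟨c⁻¹ * r, mul_pos (inv_pos.2 hc) (mem_Ioi.1 hr),
        mul_inv_cancel_left₀ hc.ne' r⟩
  have key := lintegral_image_eq_lintegral_abs_deriv_mul (s := Ioi (0 : ℝ))
    (f := fun r : ℝ => c * r) (f' := fun r => c) measurableSet_Ioi
    (fun r hr => by simpa using ((hasDerivAt_id r).const_mul c).hasDerivWithinAt)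
    (fun r _ s _ h => mul_left_cancel₀ hc.ne' h)
    (fun t => ENNReal.ofReal (t ^ (q - 1)) * g (t • x))
  rw [himg] at key
  rw [radialMoment, radialMoment, key, ← lintegral_const_mul' _ _ ENNReal.ofReal_ne_top]
  refine setLIntegral_congr_fun measurableSet_Ioi fun r hr => ?_
  have hr : 0 < r := hr
  rw [← mul_assoc, ← mul_assoc, smul_smul, mul_comm r c, ← ENNReal.ofReal_mul (by positivity),
    ← ENNReal.ofReal_mul (by positivity)]
  congr 2
  have he : -q + 1 + (q - 1) = 0 := by ring
  rw [abs_of_pos hc, Real.mul_rpow hc.le hr.le, ← mul_assoc, ← Real.rpow_add_one hc.ne',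
    ← Real.rpow_add hc, he, Real.rpow_zero, one_mul]

theorem div_le_rpow_mul_rpow {a b r s u v : ℝ} (ha : 0 < a) (hb : 0 < b) (hr : 0 < r)
    (hs : 0 < s) (hu : 0 < u) (hv : 0 < v) :
    (a * r + b * s) / (a * u + b * v) ≤
      (r / u) ^ (a * r / (a * r + b * s)) * (s / v) ^ (b * s / (a * r + b * s)) := by
  have h0 : 0 < a * r + b * s := by positivity
  have h1 := Real.geom_mean_le_arith_mean2_weighted (w₁ := a * r / (a * r + b * s))
    (w₂ := b * s / (a * r + b * s)) (p₁ := u / r) (p₂ := v / s) (by positivity) (by positivity)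
    (by positivity) (by positivity) (by field_simp)
  have h2 : a * r / (a * r + b * s) * (u / r) + b * s / (a * r + b * s) * (v / s) =
      (a * u + b * v) / (a * r + b * s) := by field_simp
  rw [h2, ← inv_div r u, ← inv_div s v, Real.inv_rpow (by positivity),
    Real.inv_rpow (by positivity), ← mul_inv,
    ← inv_div (a * r + b * s) (a * u + b * v)] at h1
  exact (inv_le_inv₀ (by positivity) (by positivity)).1 h1

/-- The scalar form of Hölder's inequality by which integrals inherit the exponent `-1/q` from
integrands that are `-1/(q+1)`-concave. -/
theorem rpow_neg_le_of_jensen {a b α β u v q : ℝ} (ha : 0 < a) (hb : 0 < b) (hα : 0 < α)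
    (hβ : 0 < β) (hu : 0 < u) (hv : 0 < v) (hq : 0 < q) :
    (a * α + b * β) ^ (-q) ≤ (a * u + b * v) ^ (-(q + 1)) *
      (a * α ^ (-q) * u ^ (q + 1) + b * β ^ (-q) * v ^ (q + 1)) := by
  have h0 : 0 < a * α + b * β := by positivity
  have h1 := (convexOn_rpow (p := q + 1) (by linarith)).2
    (show u / α ∈ Ici 0 from (by positivity : 0 ≤ u / α))
    (show v / β ∈ Ici 0 from (by positivity : 0 ≤ v / β))
    (show 0 ≤ a * α / (a * α + b * β) by positivity)
    (show 0 ≤ b * β / (a * α + b * β) by positivity) (by field_simp)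
  simp only [smul_eq_mul] at h1
  have h2 : a * α / (a * α + b * β) * (u / α) + b * β / (a * α + b * β) * (v / β) =
      (a * u + b * v) / (a * α + b * β) := by field_simp
  rw [h2, Real.div_rpow (by positivity) (by positivity), Real.div_rpow (by positivity)
    (by positivity), Real.div_rpow (by positivity) (by positivity),
    div_le_iff₀ (by positivity)] at h1
  have e : ∀ w : ℝ, 0 < w → w ^ (q + 1) = w * w ^ q := fun w hw => by
    rw [Real.rpow_add_one hw.ne', mul_comm]
  rw [Real.rpow_neg h0.le, Real.rpow_neg (by positivity : 0 ≤ a * u + b * v),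
    Real.rpow_neg hα.le, Real.rpow_neg hβ.le, inv_mul_eq_div, le_div_iff₀ (by positivity),
    inv_mul_eq_div, div_le_iff₀ (by positivity)]
  refine h1.trans (le_of_eq ?_)
  rw [e α hα, e β hβ, e _ h0]
  field_simp

/-- Ball's theorem: `x ↦ (∫₀^∞ t^(q-1) g(tx) dt)^(-1/q)` is convex for log-concave `g`. After
the substitution `t = 1/r` the integrand is `-1/(q+1)`-concave in `(x, r)`. -/
theorem LogConcave.le_radialMoment {E : Type*} [AddCommGroup E] [Module ℝ E]
    [MeasurableSpace E] [MeasurableSMul ℝ E] {g : E → ℝ≥0∞} (hg : Measurable g)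
    (hlc : LogConcave g) {C : ℝ≥0∞}
    (hC : C ≠ ⊤) (hgC : ∀ x, g x ≤ C) {q : ℝ} (hq : 0 < q) {x y : E} {T : ℝ}
    (hTx : ∀ t, T < t → g (t • x) = 0) (hTy : ∀ t, T < t → g (t • y) = 0) {a b α β : ℝ}
    (ha : 0 < a) (hb : 0 < b) (hα : 0 < α) (hβ : 0 < β)
    (hx : radialMoment q g x = ENNReal.ofReal (α ^ (-q)))
    (hy : radialMoment q g y = ENNReal.ofReal (β ^ (-q))) :
    ENNReal.ofReal ((a * α + b * β) ^ (-q)) ≤ radialMoment q g (a • x + b • y) := by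
  set s := q + 1 with hs
  have hs0 : 0 < s := by positivity
  let Φ : E → ℝ → ℝ≥0∞ := fun z => (Ioi (0 : ℝ)).indicator
    fun r => ENNReal.ofReal (r ^ (-s)) * g (r⁻¹ • z)
  have hΦm : ∀ z, Measurable (Φ z) := fun z => by
    refine Measurable.indicator ?_ measurableSet_Ioi
    fun_prop
  have hΦi : ∀ z, radialMoment q g z = ∫⁻ r, Φ z r := fun z => by
    rw [radialMoment_eq_lintegral_inv, lintegral_indicator measurableSet_Ioi]
  have hΦv : ∀ z r, 0 < r → Φ z r = ENNReal.ofReal (r ^ (-s)) * g (r⁻¹ • z) := fun z r hr =>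
    indicator_of_mem (mem_Ioi.2 hr) _
  -- The suprema are finite because `g` is bounded and vanishes far out on the two rays.
  have hsup : ∀ z, (∀ t, T < t → g (t • z) = 0) → ⨆ r, Φ z r ≠ ⊤ := by
    intro z hz
    refine ne_top_of_le_ne_top (b := ENNReal.ofReal (T ^ s) * C)
      (ENNReal.mul_ne_top ENNReal.ofReal_ne_top hC) (iSup_le fun r => ?_)
    rcases le_or_gt r 0 with hr | hr
    · have : Φ z r = 0 := indicator_of_notMem (by simpa using hr) _
      rw [this]; exact bot_le
    rw [hΦv z r hr]
    rcases lt_or_ge T r⁻¹ with h | h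
    · rw [hz _ h]; simp
    · gcongr
      · rw [Real.rpow_neg hr.le, ← Real.inv_rpow hr.le]
        exact Real.rpow_le_rpow (by positivity) h hs0.le
      · exact hgC _
  have hsup0 : ∀ z γ, 0 < γ → radialMoment q g z = ENNReal.ofReal (γ ^ (-q)) →
      ⨆ r, Φ z r ≠ 0 := by
    intro z γ hγ hz h
    have h1 : ∀ r, Φ z r = 0 := fun r => le_antisymm (h ▸ le_iSup (Φ z) r) bot_le
    rw [hΦi, lintegral_congr h1, lintegral_zero] at hz
    have : 0 < ENNReal.ofReal (γ ^ (-q)) := ENNReal.ofReal_pos.2 (by positivity)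
    exact this.ne hz
  have hrep : ∀ F : ℝ≥0∞, F ≠ 0 → F ≠ ⊤ → ∃ u : ℝ, 0 < u ∧ F = ENNReal.ofReal (u ^ (-s)) := by
    intro F h0 ht
    have hF : 0 < F.toReal := ENNReal.toReal_pos h0 ht
    refine ⟨F.toReal ^ (-(1 / s)), by positivity, ?_⟩
    rw [← Real.rpow_mul hF.le]
    have : -(1 / s) * -s = 1 := by field_simp
    rw [this, Real.rpow_one, ENNReal.ofReal_toReal ht]
  obtain ⟨u, hu, hF⟩ := hrep _ (hsup0 x α hα hx) (hsup x hTx)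
  obtain ⟨v, hv, hG⟩ := hrep _ (hsup0 y β hβ hy) (hsup y hTy)
  have pos : ∀ w : ℝ, 0 < w → ENNReal.ofReal (w ^ (-s)) ≠ 0 := fun w hw => by
    simp only [ne_eq, ENNReal.ofReal_eq_zero, not_le]; positivity
  have low : ∀ z r w, ∀ m : ℝ, 0 < m → 0 < w → 0 < r →
      ENNReal.ofReal m * ENNReal.ofReal (w ^ (-s)) ≤ Φ z r →
      ENNReal.ofReal (m * (r / w) ^ s) ≤ g (r⁻¹ • z) := by
    intro z r w m hm hw hr h
    rw [hΦv z r hr] at h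
    have h2 := mul_le_mul_right h (ENNReal.ofReal (r ^ s))
    rw [← mul_assoc, ← ENNReal.ofReal_mul (by positivity), ← mul_assoc,
      ← ENNReal.ofReal_mul (by positivity), ← ENNReal.ofReal_mul (by positivity),
      ← Real.rpow_add hr, add_neg_cancel, Real.rpow_zero, ENNReal.ofReal_one, one_mul] at h2
    refine le_trans (le_of_eq ?_) h2
    rw [Real.div_rpow hr.le hw.le, Real.rpow_neg hw.le]
    congr 1
    field_simp
  have key := lintegral_div_iSup_add_le (hΦm x) (hΦm y) (hΦm (a • x + b • y)) hF hG (pos u hu)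
    ENNReal.ofReal_ne_top (pos v hv) ENNReal.ofReal_ne_top
    (pos (a * u + b * v) (by positivity)) ENNReal.ofReal_ne_top ha hb (by
    intro r₀ r₁ m h₀ h₁
    rcases eq_or_ne m 0 with rfl | hm
    · simp
    have hr : ∀ z r w, 0 < w → m * ENNReal.ofReal (w ^ (-s)) ≤ Φ z r → 0 < r := by
      intro z r w hw h
      by_contra hr
      have h0 : Φ z r = 0 := indicator_of_notMem (by simpa using hr) _
      rw [h0, nonpos_iff_eq_zero, mul_eq_zero] at h
      exact h.elim hm (pos w hw)
    have hr₀ := hr x r₀ u hu h₀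
    have hr₁ := hr y r₁ v hv h₁
    have hmt : m ≠ ⊤ := by
      rintro rfl
      rw [ENNReal.top_mul (pos u hu), top_le_iff] at h₀
      exact hsup x hTx (top_le_iff.1 (h₀ ▸ le_iSup (Φ x) r₀))
    obtain ⟨m', hm', rfl⟩ : ∃ m' : ℝ, 0 < m' ∧ m = ENNReal.ofReal m' :=
      ⟨m.toReal, ENNReal.toReal_pos hm hmt, (ENNReal.ofReal_toReal hmt).symm⟩
    have g₀ := low x r₀ u m' hm' hu hr₀ h₀
    have g₁ := low y r₁ v m' hm' hv hr₁ h₁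
    set r := a * r₀ + b * r₁ with hrdef
    have hr0 : 0 < r := by positivity
    rw [hΦv _ r hr0]
    have hθ : 0 < a * r₀ / r := by positivity
    have hθ' : 0 < b * r₁ / r := by positivity
    have hsum : a * r₀ / r + b * r₁ / r = 1 := by rw [← add_div]; exact div_self hr0.ne'
    have hz : r⁻¹ • (a • x + b • y) =
        (a * r₀ / r) • (r₀⁻¹ • x) + (b * r₁ / r) • (r₁⁻¹ • y) := by
      rw [smul_add, smul_smul, smul_smul, smul_smul, smul_smul]
      congr 2 <;> field_simp
    have hmean := div_le_rpow_mul_rpow ha hb hr₀ hr₁ hu hv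
    rw [← hrdef] at hmean
    have g2 := hlc hθ hθ' hsum (r₀⁻¹ • x) (r₁⁻¹ • y)
    rw [← hz] at g2
    have g3 : ENNReal.ofReal (m' * (r / (a * u + b * v)) ^ s) ≤ g (r⁻¹ • (a • x + b • y)) := by
      refine le_trans ?_ g2
      refine le_trans ?_ (mul_le_mul' (ENNReal.rpow_le_rpow g₀ hθ.le)
        (ENNReal.rpow_le_rpow g₁ hθ'.le))
      rw [ENNReal.ofReal_rpow_of_pos (by positivity), ENNReal.ofReal_rpow_of_pos (by positivity),
        ← ENNReal.ofReal_mul (by positivity)]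
      refine ENNReal.ofReal_le_ofReal ?_
      calc m' * (r / (a * u + b * v)) ^ s
          ≤ m' * ((r₀ / u) ^ (a * r₀ / r) * (r₁ / v) ^ (b * r₁ / r)) ^ s := by gcongr
        _ = (m' ^ (a * r₀ / r) * m' ^ (b * r₁ / r)) *
            ((r₀ / u) ^ (a * r₀ / r) * (r₁ / v) ^ (b * r₁ / r)) ^ s := by
            rw [← Real.rpow_add hm', hsum, Real.rpow_one]
        _ = _ := by
            rw [Real.mul_rpow (by positivity) (by positivity),
              Real.mul_rpow (by positivity) (by positivity),
              Real.mul_rpow (by positivity) (by positivity),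
              ← Real.rpow_mul (by positivity), ← Real.rpow_mul (by positivity),
              ← Real.rpow_mul (by positivity), ← Real.rpow_mul (by positivity),
              mul_comm s, mul_comm s]
            ring
    refine le_trans (le_of_eq ?_) (mul_le_mul_right g3 _)
    rw [← ENNReal.ofReal_mul (by positivity), ← ENNReal.ofReal_mul (by positivity)]
    congr 1
    rw [Real.div_rpow (by positivity) (by positivity), Real.rpow_neg (by positivity),
      Real.rpow_neg (by positivity)]
    field_simp)
  rw [← hΦi, ← hΦi, ← hΦi, hx, hy] at key
  refine le_trans ?_ key
  rw [← ENNReal.ofReal_mul ha.le, ← ENNReal.ofReal_mul hb.le,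
    ← ENNReal.ofReal_div_of_pos (by positivity), ← ENNReal.ofReal_div_of_pos (by positivity),
    ← ENNReal.ofReal_add (by positivity) (by positivity), ← ENNReal.ofReal_mul (by positivity)]
  refine ENNReal.ofReal_le_ofReal ((rpow_neg_le_of_jensen ha hb hα hβ hu hv hq).trans ?_)
  rw [Real.rpow_neg hu.le, Real.rpow_neg hv.le, div_inv_eq_mul, div_inv_eq_mul]

/-! ### Symmetric log-concave densities in the plane -/

theorem radialMoment_ne_zero_of_pos {E : Type*} [NormedAddCommGroup E] [NormedSpace ℝ E]
    [MeasurableSpace E] [MeasurableSMul₂ ℝ E] {g : E → ℝ≥0∞} (hg : Measurable g)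
    {δ : ℝ} (hδ : 0 < δ) (hpos : ∀ x, ‖x‖ < δ → g x ≠ 0) (q : ℝ) (x : E) :
    radialMoment q g x ≠ 0 := by
  set d := δ / (‖x‖ + 1)
  have hd : 0 < d := by positivity
  intro h
  rw [radialMoment, lintegral_eq_zero_iff (by fun_prop)] at h
  have h2 : ∀ᵐ t ∂(volume.restrict (Ioi (0 : ℝ))), t ∉ Ioo (0 : ℝ) d := by
    filter_upwards [h] with t ht hmem
    simp only [Pi.zero_apply, mul_eq_zero, ENNReal.ofReal_eq_zero] at ht
    rcases ht with ht | ht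
    · exact absurd ht (not_le.2 (Real.rpow_pos_of_pos hmem.1 _))
    · refine hpos _ ?_ ht
      rw [norm_smul, Real.norm_of_nonneg hmem.1.le]
      calc t * ‖x‖ ≤ t * (‖x‖ + 1) := by have := hmem.1; nlinarith
        _ < δ := (lt_div_iff₀ (by positivity)).1 hmem.2
  rw [ae_iff] at h2
  simp only [not_not, ofPred_mem_eq] at h2
  rw [Measure.restrict_apply measurableSet_Ioo,
    inter_eq_left.2 (fun t ht => ht.1), Real.volume_Ioo] at h2
  simp only [sub_zero, ENNReal.ofReal_eq_zero] at h2
  linarith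

/-- The hypotheses on a density in the plane under which its potentials are studied: even,
log-concave, bounded, of bounded support, and bounded below near the origin. -/
structure IsSymmLogConcaveDensity (g : ℝ × ℝ → ℝ≥0∞) : Prop where
  measurable : Measurable g
  logConcave : LogConcave g
  even : ∀ x, g (-x) = g x
  bounded : ∃ C : ℝ≥0∞, C ≠ ⊤ ∧ ∀ x, g x ≤ C
  support : ∃ R : ℝ, 0 < R ∧ ∀ x, R < ‖x‖ → g x = 0
  pos : ∃ δ : ℝ, 0 < δ ∧ ∃ c : ℝ≥0∞, c ≠ 0 ∧ ∀ x, ‖x‖ < δ → c ≤ g x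

/-- The gauge `(∫₀^∞ t^(q-1) g(tx) dt)^(-1/q)` of Ball's body of `g`. -/
def momentGauge (q : ℝ) (g : ℝ × ℝ → ℝ≥0∞) (x : ℝ × ℝ) : ℝ :=
  (radialMoment q g x).toReal ^ (-(1 / q))

namespace IsSymmLogConcaveDensity

variable {g : ℝ × ℝ → ℝ≥0∞} {q : ℝ}

theorem radialMoment_ne_top (hg : IsSymmLogConcaveDensity g) (hq : 1 ≤ q) {x : ℝ × ℝ}
    (hx : x ≠ 0) : radialMoment q g x ≠ ⊤ := by
  obtain ⟨C, hC, hgC⟩ := hg.bounded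
  obtain ⟨R, hR, hgR⟩ := hg.support
  have hx0 : 0 < ‖x‖ := norm_pos_iff.2 hx
  set T := R / ‖x‖
  have hT : 0 < T := by positivity
  have h1 : radialMoment q g x ≤
      ∫⁻ t in Ioi (0 : ℝ), (Ioc 0 T).indicator (fun _ => ENNReal.ofReal (T ^ (q - 1)) * C) t := by
    refine setLIntegral_mono' measurableSet_Ioi fun t ht => ?_
    have ht : 0 < t := ht
    rcases le_or_gt t T with h | h
    · rw [indicator_of_mem (show t ∈ Ioc 0 T from ⟨ht, h⟩)]
      gcongr
      exact hgC _
    · rw [hgR (t • x), mul_zero]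
      · exact bot_le
      · rw [norm_smul, Real.norm_of_nonneg ht.le]
        exact (div_lt_iff₀ hx0).1 h
  refine ne_top_of_le_ne_top ?_ (h1.trans (setLIntegral_le_lintegral _ _))
  rw [lintegral_indicator_const measurableSet_Ioc]
  exact ENNReal.mul_ne_top (ENNReal.mul_ne_top ENNReal.ofReal_ne_top hC) (by simp)

theorem radialMoment_ne_zero (hg : IsSymmLogConcaveDensity g) (q : ℝ) (x : ℝ × ℝ) :
    radialMoment q g x ≠ 0 := by
  obtain ⟨δ, hδ, c, hc, hgc⟩ := hg.pos
  exact radialMoment_ne_zero_of_pos hg.measurable hδ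
    (fun y hy h => hc (le_antisymm (h ▸ hgc y hy) bot_le)) q x

theorem momentGauge_pos (hg : IsSymmLogConcaveDensity g) (hq : 1 ≤ q) {x : ℝ × ℝ}
    (hx : x ≠ 0) : 0 < momentGauge q g x :=
  Real.rpow_pos_of_pos
    (ENNReal.toReal_pos (hg.radialMoment_ne_zero q x) (hg.radialMoment_ne_top hq hx)) _

theorem radialMoment_eq (hg : IsSymmLogConcaveDensity g) (hq : 1 ≤ q) {x : ℝ × ℝ}
    (hx : x ≠ 0) : radialMoment q g x = ENNReal.ofReal (momentGauge q g x ^ (-q)) := by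
  have h := ENNReal.toReal_pos (hg.radialMoment_ne_zero q x) (hg.radialMoment_ne_top hq hx)
  have e : -(1 / q) * -q = 1 := by field_simp
  rw [momentGauge, ← Real.rpow_mul h.le, e, Real.rpow_one,
    ENNReal.ofReal_toReal (hg.radialMoment_ne_top hq hx)]

theorem momentGauge_smul (hq : 1 ≤ q) (x : ℝ × ℝ) {c : ℝ} (hc : 0 < c) :
    momentGauge q g (c • x) = c * momentGauge q g x := by
  have e : -q * -(1 / q) = 1 := by field_simp
  rw [momentGauge, radialMoment_smul q g x hc, ENNReal.toReal_mul,
    ENNReal.toReal_ofReal (by positivity), Real.mul_rpow (by positivity) ENNReal.toReal_nonneg,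
    ← Real.rpow_mul hc.le, e, Real.rpow_one, momentGauge]

theorem momentGauge_convex (hg : IsSymmLogConcaveDensity g) (hq : 1 ≤ q) {x y : ℝ × ℝ}
    (hx : x ≠ 0) (hy : y ≠ 0) {a b : ℝ} (ha : 0 < a) (hb : 0 < b) (hxy : a • x + b • y ≠ 0) :
    momentGauge q g (a • x + b • y) ≤ a * momentGauge q g x + b * momentGauge q g y := by
  obtain ⟨C, hC, hgC⟩ := hg.bounded
  obtain ⟨R, hR, hgR⟩ := hg.support
  have hcut : ∀ z : ℝ × ℝ, z ≠ 0 → ∀ t, R / ‖z‖ < t → g (t • z) = 0 := by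
    intro z hz t ht
    have hz0 : 0 < ‖z‖ := norm_pos_iff.2 hz
    have ht0 : 0 < t := lt_trans (by positivity) ht
    refine hgR _ ?_
    rw [norm_smul, Real.norm_of_nonneg ht0.le]
    exact (div_lt_iff₀ hz0).1 ht
  have hαpos := hg.momentGauge_pos hq hx
  have hβpos := hg.momentGauge_pos hq hy
  have key := LogConcave.le_radialMoment hg.measurable hg.logConcave hC hgC
    (by linarith : 0 < q) (T := max (R / ‖x‖) (R / ‖y‖))
    (fun t ht => hcut x hx t ((le_max_left _ _).trans_lt ht))
    (fun t ht => hcut y hy t ((le_max_right _ _).trans_lt ht)) ha hb hαpos hβpos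
    (hg.radialMoment_eq hq hx) (hg.radialMoment_eq hq hy)
  rw [hg.radialMoment_eq hq hxy] at key
  have hz := hg.momentGauge_pos hq hxy
  have h2 := (ENNReal.ofReal_le_ofReal_iff (by positivity)).1 key
  exact (Real.rpow_le_rpow_iff_of_neg (by positivity) hz (by linarith)).1 h2

theorem convexOn_momentGauge_line (hg : IsSymmLogConcaveDensity g) (hq : 1 ≤ q) (c : ℝ) :
    ConvexOn ℝ univ fun w : ℝ => momentGauge q g (w, 1 - c * w) := by
  have hne : ∀ w : ℝ, (w, 1 - c * w) ≠ (0 : ℝ × ℝ) := by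
    intro w h
    simp only [Prod.mk_eq_zero] at h
    obtain ⟨rfl, h⟩ := h
    simp at h
  refine convexOn_iff_forall_pos.2 ⟨convex_univ, fun x _ y _ a b ha hb hab => ?_⟩
  have e : ((a • x + b • y, 1 - c * (a • x + b • y)) : ℝ × ℝ) =
      a • ((x, 1 - c * x) : ℝ × ℝ) + b • ((y, 1 - c * y) : ℝ × ℝ) := by
    ext
    · simp
    · simp only [smul_eq_mul, Prod.snd_add, Prod.smul_snd]
      linear_combination -hab
  have h := hg.momentGauge_convex hq (hne x) (hne y) ha hb (e ▸ hne _)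
  rw [e]
  exact h

/-- The line through `(0, 1)` in the direction of a supporting line of Ball's body there: the
gauge is least at `(0, 1)`. -/
theorem exists_line_momentGauge_min (hg : IsSymmLogConcaveDensity g) (hq : 1 ≤ q) :
    ∃ c : ℝ, ∀ w, momentGauge q g (0, 1) ≤ momentGauge q g (w, 1 - c * w) := by
  have hconv := hg.convexOn_momentGauge_line hq 0
  simp only [zero_mul, sub_zero] at hconv
  set f : ℝ → ℝ := fun w => momentGauge q g (w, 1) with hf
  obtain ⟨d, hd⟩ : ∃ d : ℝ, ∀ w, f 0 + d * w ≤ f w := by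
    refine ⟨derivWithin f (Ioi 0) 0, fun w => ?_⟩
    have h0 : (0 : ℝ) ∈ interior univ := by simp
    rcases lt_trichotomy w 0 with hw | rfl | hw
    · have h1 := hconv.slope_le_leftDeriv_of_mem_interior (mem_univ w) h0 hw
      have h2 := h1.trans (hconv.leftDeriv_le_rightDeriv_of_mem_interior h0)
      rw [slope_def_field, div_le_iff₀ (by linarith)] at h2
      linarith
    · simp
    · have h1 := hconv.rightDeriv_le_slope_of_mem_interior h0 (mem_univ w) hw
      rw [slope_def_field, le_div_iff₀ (by linarith)] at h1
      linarith
  have hf0 : 0 < f 0 := hg.momentGauge_pos hq (by simp)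
  set c := d / f 0 with hc
  refine ⟨c, fun w => ?_⟩
  have hmin : IsLocalMin (fun w : ℝ => momentGauge q g (w, 1 - c * w)) 0 := by
    have hcont : ContinuousAt (fun w : ℝ => 1 - c * w) 0 := by fun_prop
    have hev : ∀ᶠ w in nhds (0 : ℝ), 0 < 1 - c * w :=
      hcont.eventually (lt_mem_nhds (by simp))
    filter_upwards [hev] with w hw
    have e : ((w, 1 - c * w) : ℝ × ℝ) = (1 - c * w) • ((w / (1 - c * w), 1) : ℝ × ℝ) := by
      ext
      · simp only [Prod.smul_fst, smul_eq_mul]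
        rw [mul_comm, div_mul_cancel₀ w hw.ne']
      · simp
    have h1 := hd (w / (1 - c * w))
    rw [e, momentGauge_smul hq _ hw]
    have h2 := mul_le_mul_of_nonneg_left h1 hw.le
    simp only [mul_zero, sub_zero]
    refine le_trans (le_of_eq ?_) h2
    have h3 : d = c * f 0 := by rw [hc]; field_simp
    rw [h3]
    field_simp
    simp only [hf]
    ring
  have := IsMinOn.of_isLocalMin_of_convex_univ hmin (hg.convexOn_momentGauge_line hq c) w
  simpa using this

/-- Along a suitable line through `(0, 1)` the radial moment is unimodal with mode at `(0, 1)`. -/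
theorem exists_line_radialMoment_unimodal (hg : IsSymmLogConcaveDensity g) (hq : 1 ≤ q) :
    ∃ c : ℝ, AntitoneOn (fun w : ℝ => radialMoment q g (w, 1 - c * w)) (Ici 0) ∧
      MonotoneOn (fun w : ℝ => radialMoment q g (w, 1 - c * w)) (Iic 0) := by
  obtain ⟨c, hc⟩ := hg.exists_line_momentGauge_min hq
  have hconv := hg.convexOn_momentGauge_line hq c
  have hne : ∀ w : ℝ, (w, 1 - c * w) ≠ (0 : ℝ × ℝ) := by
    intro w h
    simp only [Prod.mk_eq_zero] at h
    obtain ⟨rfl, h⟩ := h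
    simp at h
  have hle : ∀ w w', momentGauge q g (w, 1 - c * w) ≤ momentGauge q g (w', 1 - c * w') →
      radialMoment q g (w', 1 - c * w') ≤ radialMoment q g (w, 1 - c * w) := by
    intro w w' h
    rw [hg.radialMoment_eq hq (hne w), hg.radialMoment_eq hq (hne w')]
    exact ENNReal.ofReal_le_ofReal (Real.rpow_le_rpow_of_nonpos (hg.momentGauge_pos hq (hne w)) h
      (by linarith))
  refine ⟨c, fun x hx y hy hxy => hle _ _ ?_, fun x hx y hy hxy => hle _ _ ?_⟩
  · have h := hconv.le_max_of_mem_Icc (mem_univ 0) (mem_univ y)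
      (show x ∈ Icc 0 y from ⟨hx, hxy⟩)
    refine h.trans (max_le ?_ le_rfl)
    simpa using hc y
  · have h := hconv.le_max_of_mem_Icc (mem_univ x) (mem_univ 0)
      (show y ∈ Icc x 0 from ⟨hxy, hy⟩)
    refine h.trans (max_le le_rfl ?_)
    simpa using hc x

end IsSymmLogConcaveDensity

/-! ### The Riesz kernel and rearrangement -/

/-- The Riesz-type kernel `|u|^(-p)`, infinite at `0`. -/
def rieszKernel (p u : ℝ) : ℝ≥0∞ := ENNReal.ofReal |u| ^ (-p)

theorem continuous_rieszKernel (p : ℝ) : Continuous (rieszKernel p) :=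
  ENNReal.continuous_rpow_const.comp (ENNReal.continuous_ofReal.comp continuous_abs)

@[fun_prop]
theorem measurable_rieszKernel (p : ℝ) : Measurable (rieszKernel p) :=
  (continuous_rieszKernel p).measurable

theorem rieszKernel_neg (p u : ℝ) : rieszKernel p (-u) = rieszKernel p u := by
  simp [rieszKernel]

theorem rieszKernel_mul (p : ℝ) {t : ℝ} (ht : t ≠ 0) (u : ℝ) :
    rieszKernel p (t * u) = ENNReal.ofReal (|t| ^ (-p)) * rieszKernel p u := by
  have ht' : 0 < |t| := abs_pos.2 ht
  rw [rieszKernel, rieszKernel, abs_mul, ENNReal.ofReal_mul ht'.le,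
    ENNReal.mul_rpow_of_ne_top ENNReal.ofReal_ne_top ENNReal.ofReal_ne_top,
    ENNReal.ofReal_rpow_of_pos ht']

theorem rieszKernel_anti {p : ℝ} (hp : 0 ≤ p) {u v : ℝ} (h : |u| ≤ |v|) :
    rieszKernel p v ≤ rieszKernel p u := by
  rw [rieszKernel, rieszKernel, ENNReal.rpow_neg, ENNReal.rpow_neg]
  gcongr

/-- A Riesz-type rearrangement inequality: averaging the translates by `±h` of the kernel lowers
the integral against a unimodal function. -/
theorem lintegral_unimodal_le {k φ : ℝ → ℝ≥0∞} (hk : Measurable k)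
    (hk1 : AntitoneOn k (Ici 0)) (hk2 : MonotoneOn k (Iic 0)) (hφ : Measurable φ)
    (hφ1 : ∀ u, φ (-u) = φ u) (hφ2 : ∀ u v, |u| ≤ |v| → φ v ≤ φ u) (h : ℝ) :
    (∫⁻ w, k w * φ (w + h)) + (∫⁻ w, k w * φ (w - h)) ≤ 2 * ∫⁻ w, k w * φ w := by
  set K : ℝ → ℝ≥0∞ := fun w => k w + k (-w) with hKdef
  have hKm : Measurable K := by fun_prop
  have hKe : ∀ w, K (-w) = K w := fun w => by simp [hKdef, add_comm]
  have hKabs : ∀ w, K w = k |w| + k (-|w|) := by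
    intro w
    rcases abs_choice w with h | h <;> rw [h]
    simp [hKdef, add_comm]
  have hK2 : ∀ u v, |u| ≤ |v| → K v ≤ K u := by
    intro u v huv
    rw [hKabs, hKabs]
    refine add_le_add (hk1 (abs_nonneg u) (abs_nonneg v) huv) (hk2 ?_ ?_ (by linarith)) <;> simp
  -- `∫ k ψ + ∫ k ψ(-·) = ∫ K ψ`
  have hsymm : ∀ ψ : ℝ → ℝ≥0∞, Measurable ψ →
      (∫⁻ w, k w * ψ w) + ∫⁻ w, k w * ψ (-w) = ∫⁻ w, K w * ψ w := by
    intro ψ hψ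
    have e : ∫⁻ w, k w * ψ (-w) = ∫⁻ w, k (-w) * ψ w := by
      rw [← lintegral_neg_eq_self (μ := volume) (fun w : ℝ => k w * ψ (-w))]
      simp
    rw [e, ← lintegral_add_left (by fun_prop)]
    simp only [hKdef, add_mul]
  have e1 : (∫⁻ w, k w * φ (w + h)) + (∫⁻ w, k w * φ (w - h)) = ∫⁻ w, K w * φ (w + h) := by
    rw [← hsymm (fun w => φ (w + h)) (by fun_prop)]
    congr 1
    refine lintegral_congr fun w => ?_
    rw [← hφ1 (w - h)]
    congr 2
    ring
  have e2 : 2 * ∫⁻ w, k w * φ w = ∫⁻ w, K w * φ w := by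
    rw [← hsymm φ hφ, two_mul]
    simp only [hφ1]
  have e3 : ∫⁻ w, K (w + h) * φ w = ∫⁻ w, K w * φ (w + h) := by
    rw [← lintegral_sub_right_eq_self (μ := volume) (fun w => K (w + h) * φ w) h,
      ← lintegral_neg_eq_self (μ := volume)]
    refine lintegral_congr fun w => ?_
    rw [sub_add_cancel, hKe, ← hφ1]
    congr 2
    ring
  have e4 : ∫⁻ w, K (w + h) * φ (w + h) = ∫⁻ w, K w * φ w :=
    lintegral_add_right_eq_self (μ := volume) (fun w => K w * φ w) h
  rw [e1, e2]
  have key : (∫⁻ w, K w * φ (w + h)) + (∫⁻ w, K w * φ (w + h)) ≤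
      (∫⁻ w, K w * φ w) + ∫⁻ w, K w * φ w := by
    calc (∫⁻ w, K w * φ (w + h)) + (∫⁻ w, K w * φ (w + h))
        = ∫⁻ w, (K w * φ (w + h) + K (w + h) * φ w) := by
          rw [lintegral_add_left (by fun_prop), e3]
      _ ≤ ∫⁻ w, (K w * φ w + K (w + h) * φ (w + h)) := by
          refine lintegral_mono fun w => ?_
          rcases le_total |w| |w + h| with hw | hw
          · obtain ⟨e, he⟩ := exists_add_of_le (hK2 _ _ hw)
            have := hφ2 _ _ hw
            simp only [he, add_mul]
            calc K (w + h) * φ (w + h) + e * φ (w + h) + K (w + h) * φ w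
                ≤ K (w + h) * φ (w + h) + e * φ w + K (w + h) * φ w := by gcongr
              _ = _ := by ring
          · obtain ⟨e, he⟩ := exists_add_of_le (hK2 _ _ hw)
            have := hφ2 _ _ hw
            simp only [he, add_mul]
            calc K w * φ (w + h) + (K w * φ w + e * φ w)
                ≤ K w * φ (w + h) + (K w * φ w + e * φ (w + h)) := by gcongr
              _ = _ := by ring
      _ = (∫⁻ w, K w * φ w) + ∫⁻ w, K w * φ w := by
          rw [lintegral_add_left (by fun_prop), e4]
  rw [← two_mul, ← two_mul] at key
  exact (ENNReal.mul_le_mul_iff_right (by simp) (by simp)).1 key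

/-! ### Potentials of planar densities -/

theorem lintegral_eq_abs_mul_lintegral_comp_mul {G : ℝ → ℝ≥0∞} (hG : Measurable G) {t : ℝ}
    (ht : t ≠ 0) : ∫⁻ s, G s = ENNReal.ofReal |t| * ∫⁻ w, G (t * w) := by
  conv_lhs => rw [← Real.smul_map_volume_mul_left ht]
  rw [lintegral_smul_measure, lintegral_map hG (by fun_prop), smul_eq_mul]

theorem lintegral_eq_two_mul_of_even {F : ℝ → ℝ≥0∞} (hF : ∀ t, F (-t) = F t) :
    ∫⁻ t, F t = 2 * ∫⁻ t in Ioi (0 : ℝ), F t := by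
  have h1 : ∫⁻ t in Iio (0 : ℝ), F t = ∫⁻ t in Ioi (0 : ℝ), F t := by
    have := (Measure.measurePreserving_neg (volume : Measure ℝ)).setLIntegral_comp_preimage_emb
      (MeasurableEquiv.neg ℝ).measurableEmbedding F (Ioi 0)
    simp only [hF] at this
    rw [← this]
    congr 2
    ext t
    simp
  rw [← lintegral_add_compl F (measurableSet_Ioi (a := (0 : ℝ))), compl_Ioi,
    setLIntegral_congr Iio_ae_eq_Iic.symm, h1, two_mul]

theorem measurable_radialMoment {g : ℝ × ℝ → ℝ≥0∞} (hg : Measurable g) (q : ℝ) :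
    Measurable (radialMoment q g) := by
  unfold radialMoment
  exact Measurable.lintegral_prod_right'
    (f := fun z : (ℝ × ℝ) × ℝ => ENNReal.ofReal (z.2 ^ (q - 1)) * g (z.2 • z.1)) (by fun_prop)

/-- The potential `∫ g(z) |⟨(x, y), z⟩|^(-p) dz` of a planar density. -/
def planarPotential (p : ℝ) (g : ℝ × ℝ → ℝ≥0∞) (x y : ℝ) : ℝ≥0∞ :=
  ∫⁻ z : ℝ × ℝ, g z * rieszKernel p (x * z.1 + y * z.2)

/-- In the projective coordinate `w` of the line `{(w, 1 - cw)}`, the potential is a convolution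
of the kernel with the radial moments of order `2 - p`. -/
theorem planarPotential_eq_lintegral_radialMoment {g : ℝ × ℝ → ℝ≥0∞} (hg : Measurable g)
    (heven : ∀ x, g (-x) = g x) (p c h : ℝ) :
    planarPotential p g (1 + h * c) h =
      2 * ∫⁻ w, radialMoment (2 - p) g (w, 1 - c * w) * rieszKernel p (w + h) := by
  have hshear : ∀ s : ℝ, ∫⁻ t, g (s, t) * rieszKernel p ((1 + h * c) * s + h * t) =
      ∫⁻ t, g (s, t - c * s) * rieszKernel p (s + h * t) := by
    intro s
    rw [← lintegral_sub_right_eq_self (μ := volume)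
      (fun t => g (s, t) * rieszKernel p ((1 + h * c) * s + h * t)) (c * s)]
    refine lintegral_congr fun t => ?_
    congr 2
    ring
  have hscale : ∀ t : ℝ, t ≠ 0 → ∫⁻ s, g (s, t - c * s) * rieszKernel p (s + h * t) =
      ∫⁻ w, ENNReal.ofReal (|t| ^ (1 - p)) * g (t • ((w, 1 - c * w) : ℝ × ℝ)) *
        rieszKernel p (w + h) := by
    intro t ht
    have ht' : 0 < |t| := abs_pos.2 ht
    rw [lintegral_eq_abs_mul_lintegral_comp_mul (by fun_prop) ht,
      ← lintegral_const_mul' _ _ ENNReal.ofReal_ne_top]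
    refine lintegral_congr fun w => ?_
    have e1 : t * w + h * t = t * (w + h) := by ring
    have e2 : ((t * w, t - c * (t * w)) : ℝ × ℝ) = t • ((w, 1 - c * w) : ℝ × ℝ) := by
      ext
      · simp
      · simp only [Prod.smul_snd, smul_eq_mul]; ring
    have e3 : |t| ^ (1 - p) = |t| * |t| ^ (-p) := by
      rw [sub_eq_add_neg, Real.rpow_add ht', Real.rpow_one]
    rw [e1, e2, e3, rieszKernel_mul p ht, ENNReal.ofReal_mul ht'.le]
    ring
  have hmoment : ∀ w : ℝ, ∫⁻ t : ℝ, ENNReal.ofReal (|t| ^ (1 - p)) *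
      g (t • ((w, 1 - c * w) : ℝ × ℝ)) = 2 * radialMoment (2 - p) g (w, 1 - c * w) := by
    intro w
    rw [lintegral_eq_two_mul_of_even, radialMoment]
    · congr 1
      refine setLIntegral_congr_fun measurableSet_Ioi fun t ht => ?_
      have ht : 0 < t := ht
      simp only [abs_of_pos ht]
      congr 3
      ring
    · intro t
      rw [abs_neg, neg_smul, heven]
  have hmm := measurable_radialMoment hg (2 - p)
  calc planarPotential p g (1 + h * c) h
      = ∫⁻ s, ∫⁻ t, g (s, t) * rieszKernel p ((1 + h * c) * s + h * t) := by
        rw [planarPotential, Measure.volume_eq_prod, lintegral_prod _ (by fun_prop)]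
    _ = ∫⁻ t, ∫⁻ s, g (s, t - c * s) * rieszKernel p (s + h * t) := by
        rw [lintegral_congr hshear, lintegral_lintegral_swap (by fun_prop)]
    _ = ∫⁻ t, ∫⁻ w, ENNReal.ofReal (|t| ^ (1 - p)) * g (t • ((w, 1 - c * w) : ℝ × ℝ)) *
        rieszKernel p (w + h) := by
        refine lintegral_congr_ae ?_
        filter_upwards [Measure.ae_ne volume (0 : ℝ)] with t ht using hscale t ht
    _ = ∫⁻ w, ∫⁻ t, ENNReal.ofReal (|t| ^ (1 - p)) * g (t • ((w, 1 - c * w) : ℝ × ℝ)) *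
        rieszKernel p (w + h) := lintegral_lintegral_swap (by fun_prop)
    _ = 2 * ∫⁻ w, radialMoment (2 - p) g (w, 1 - c * w) * rieszKernel p (w + h) := by
        rw [← lintegral_const_mul _ (by fun_prop)]
        refine lintegral_congr fun w => ?_
        rw [lintegral_mul_const _ (by fun_prop), hmoment, mul_assoc]

/-- Midpoint concavity of the potential at `(1, 0)` in one direction transversal to `(1, 0)`. -/
theorem IsSymmLogConcaveDensity.exists_planarPotential_add_le {g : ℝ × ℝ → ℝ≥0∞}
    (hg : IsSymmLogConcaveDensity g) {p : ℝ} (hp0 : 0 ≤ p) (hp1 : p ≤ 1) :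
    ∃ c : ℝ, ∀ h : ℝ, planarPotential p g (1 + h * c) h + planarPotential p g (1 - h * c) (-h) ≤
      2 * planarPotential p g 1 0 := by
  obtain ⟨c, h1, h2⟩ := hg.exists_line_radialMoment_unimodal (q := 2 - p) (by linarith)
  refine ⟨c, fun h => ?_⟩
  have hmm := measurable_radialMoment hg.measurable (2 - p)
  have e := planarPotential_eq_lintegral_radialMoment hg.measurable hg.even p c
  have e1 := e h
  have e2 := e (-h)
  have e3 := e 0
  simp only [neg_mul, ← sub_eq_add_neg] at e2
  simp only [zero_mul, add_zero] at e3
  rw [e1, e2, e3, ← mul_add]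
  gcongr
  exact lintegral_unimodal_le (by fun_prop) h1 h2 (measurable_rieszKernel p) (rieszKernel_neg p)
    (fun u v huv => rieszKernel_anti hp0 huv) h

/-! ### Convexity from a local midpoint condition -/

theorem linearIndependent_pair_segment {E : Type*} [AddCommGroup E] [Module ℝ E] {x y : E}
    (hxy : LinearIndependent ℝ ![x, y]) (t : ℝ) :
    LinearIndependent ℝ ![(1 - t) • x + t • y, y - x] := by
  rw [LinearIndependent.pair_iff] at hxy ⊢
  intro r s h
  have h2 := hxy (r * (1 - t) - s) (r * t + s) (by
    rw [← h]; module)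
  have hr : r = 0 := by linarith [h2.1, h2.2]
  subst hr
  refine ⟨rfl, by linarith [h2.2]⟩

/-- Convexity from a local condition in which the two comparison points may depend on the
direction chosen at `a`: a strictly convex perturbation of the difference with the chord would
otherwise have an interior maximum violating the condition. -/
theorem add_le_of_local_midpoint {E : Type*} [NormedAddCommGroup E] [NormedSpace ℝ E]
    {Ψ : E → ℝ} (hom : ∀ (c : ℝ) (x : E), 0 < c → Ψ (c • x) = c * Ψ x)
    (usc : ∀ x, x ≠ 0 → UpperSemicontinuousAt Ψ x)
    (loc : ∀ a b : E, LinearIndependent ℝ ![a, b] → ∃ c : ℝ, ∀ h : ℝ,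
      2 * Ψ a ≤ Ψ ((1 + h * c) • a + h • b) + Ψ ((1 - h * c) • a - h • b))
    {x y : E} (hxy : LinearIndependent ℝ ![x, y]) : Ψ (x + y) ≤ Ψ x + Ψ y := by
  by_contra hcon
  push Not at hcon
  set P : ℝ → E := fun t => (1 - t) • x + t • y with hP
  have hP0 : ∀ t, P t ≠ 0 := fun t =>
    (linearIndependent_pair_segment hxy t).ne_zero 0
  set D := Ψ (x + y) - Ψ x - Ψ y with hD
  have hDpos : 0 < D := by rw [hD]; linarith
  set ε := D / 4 with hε
  set F : ℝ → ℝ := fun t => Ψ (P t) + (-(1 - t) * Ψ x - t * Ψ y + ε * t ^ 2) with hF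
  have hFu : UpperSemicontinuousOn F (Icc 0 1) := by
    intro t _
    apply UpperSemicontinuousAt.upperSemicontinuousWithinAt
    refine UpperSemicontinuousAt.add ?_ (Continuous.upperSemicontinuous (by fun_prop) t)
    have hPc : ContinuousAt P t := by fun_prop
    intro z hz
    exact hPc.eventually (usc (P t) (hP0 t) z hz)
  obtain ⟨s, hs, hmax⟩ := hFu.exists_isMaxOn (nonempty_Icc.2 zero_le_one) isCompact_Icc
  have hmax' : ∀ t ∈ Icc (0 : ℝ) 1, F t ≤ F s := fun t ht => hmax ht
  have hhalf : F (1 / 2) = D / 2 + ε / 4 := by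
    have : P (1 / 2) = (1 / 2 : ℝ) • (x + y) := by simp only [hP]; module
    simp only [hF, this, hom (1 / 2) (x + y) (by norm_num), hD]
    ring
  have hF0 : F 0 = 0 := by simp [hF, hP]
  have hF1 : F 1 = ε := by simp [hF, hP]
  have hmid := hmax' (1 / 2) (by norm_num)
  have hs0 : 0 < s := by
    rcases hs.1.eq_or_lt with h | h
    · rw [← h, hF0] at hmid; linarith
    · exact h
  have hs1 : s < 1 := by
    rcases hs.2.eq_or_lt with h | h
    · rw [h, hF1] at hmid; linarith
    · exact h
  obtain ⟨c, hc⟩ := loc _ _ (linearIndependent_pair_segment hxy s)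
  -- `h` is so small that both comparison points lie on the segment.
  set m := min s (1 - s) with hm
  have hmpos : 0 < m := lt_min hs0 (by linarith)
  have hm1 : m ≤ 1 / 2 := by
    rcases le_total s (1 / 2) with h | h
    · exact (min_le_left _ _).trans h
    · exact (min_le_right _ _).trans (by linarith)
  set h := m / (2 * (1 + |c|)) with hh
  have hden : 0 < 2 * (1 + |c|) := by positivity
  have hhpos : 0 < h := by positivity
  have hhm : h * (2 * (1 + |c|)) = m := div_mul_cancel₀ _ hden.ne'
  have hhc : |h * c| ≤ 1 / 2 := by
    rw [abs_mul, abs_of_pos hhpos]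
    nlinarith [abs_nonneg c]
  have hh2 : 2 * h ≤ m := by nlinarith [abs_nonneg c]
  obtain ⟨hc1, hc2⟩ := abs_le.1 hhc
  have hp1 : 0 < 1 + h * c := by linarith
  have hp2 : 0 < 1 - h * c := by linarith
  have hq1 : h / (1 + h * c) ≤ m := by
    rw [div_le_iff₀ hp1]; nlinarith
  have hq2 : h / (1 - h * c) ≤ m := by
    rw [div_le_iff₀ hp2]; nlinarith
  have hr1 : 0 < h / (1 + h * c) := by positivity
  have hr2 : 0 < h / (1 - h * c) := by positivity
  have hms : m ≤ s := min_le_left _ _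
  have hms' : m ≤ 1 - s := min_le_right _ _
  have e1 : (1 + h * c) • P s + h • (y - x) = (1 + h * c) • P (s + h / (1 + h * c)) := by
    have : h = (1 + h * c) * (h / (1 + h * c)) := by field_simp
    simp only [hP]
    rw [show h • (y - x) = ((1 + h * c) * (h / (1 + h * c))) • (y - x) by rw [← this]]
    module
  have e2 : (1 - h * c) • P s - h • (y - x) = (1 - h * c) • P (s - h / (1 - h * c)) := by
    have : h = (1 - h * c) * (h / (1 - h * c)) := by field_simp
    simp only [hP]
    rw [show h • (y - x) = ((1 - h * c) * (h / (1 - h * c))) • (y - x) by rw [← this]]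
    module
  have key := hc h
  change 2 * Ψ (P s) ≤ Ψ ((1 + h * c) • P s + h • (y - x)) +
    Ψ ((1 - h * c) • P s - h • (y - x)) at key
  rw [e1, e2, hom _ _ hp1, hom _ _ hp2] at key
  have f1 := hmax' (s + h / (1 + h * c)) ⟨by linarith, by linarith⟩
  have f2 := hmax' (s - h / (1 - h * c)) ⟨by linarith, by linarith⟩
  set u := h / (1 + h * c) with hu
  set v := h / (1 - h * c) with hv
  have hu' : (1 + h * c) * u = h := by rw [hu]; field_simp
  have hv' : (1 - h * c) * v = h := by rw [hv]; field_simp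
  have g1 := mul_le_mul_of_nonneg_left f1 hp1.le
  have g2 := mul_le_mul_of_nonneg_left f2 hp2.le
  simp only [hF] at g1 g2
  have hε0 : 0 < ε := by positivity
  have i1 : (1 + h * c) * (s + u) ^ 2 = (1 + h * c) * s ^ 2 + 2 * s * h + h * u := by
    linear_combination (2 * s + u) * hu'
  have i2 : (1 - h * c) * (s - v) ^ 2 = (1 - h * c) * s ^ 2 - 2 * s * h + h * v := by
    linear_combination (v - 2 * s) * hv'
  have j1 : (1 + h * c) * (-(1 - (s + u)) * Ψ x - (s + u) * Ψ y) =
      (1 + h * c) * (-(1 - s) * Ψ x - s * Ψ y) + h * (Ψ x - Ψ y) := by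
    linear_combination (Ψ x - Ψ y) * hu'
  have j2 : (1 - h * c) * (-(1 - (s - v)) * Ψ x - (s - v) * Ψ y) =
      (1 - h * c) * (-(1 - s) * Ψ x - s * Ψ y) - h * (Ψ x - Ψ y) := by
    linear_combination -(Ψ x - Ψ y) * hv'
  have k1 : 0 < ε * (h * u) := by positivity
  have k2 : 0 < ε * (h * v) := by positivity
  have i1' := congrArg (ε * ·) i1
  have i2' := congrArg (ε * ·) i2
  linarith only [g1, g2, i1', i2', j1, j2, k1, k2, key]

/-! ### Planar marginals of a convex body -/

theorem LogConcave.mul {E : Type*} [AddCommGroup E] [Module ℝ E] {f g : E → ℝ≥0∞}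
    (hf : LogConcave f) (hg : LogConcave g) : LogConcave fun x => f x * g x := by
  intro a b ha hb hab x y
  refine le_trans (le_of_eq ?_) (mul_le_mul' (hf ha hb hab x y) (hg ha hb hab x y))
  rw [ENNReal.mul_rpow_of_nonneg _ _ ha.le, ENNReal.mul_rpow_of_nonneg _ _ hb.le,
    mul_mul_mul_comm]

theorem LogConcave.comp_linearMap {E F : Type*} [AddCommGroup E] [Module ℝ E] [AddCommGroup F]
    [Module ℝ F] {f : F → ℝ≥0∞} (hf : LogConcave f) (T : E →ₗ[ℝ] F) :
    LogConcave fun x => f (T x) := by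
  intro a b ha hb hab x y
  simpa using hf ha hb hab (T x) (T y)

theorem Convex.logConcave_indicator {E : Type*} [AddCommGroup E] [Module ℝ E] {s : Set E}
    (hs : Convex ℝ s) : LogConcave (s.indicator fun _ => (1 : ℝ≥0∞)) := by
  intro a b ha hb hab x y
  by_cases hx : x ∈ s
  · by_cases hy : y ∈ s
    · simp [hx, hy, hs hx hy ha.le hb.le hab]
    · simp [hy, hb]
  · simp [hx, ha]

/-- Prékopa's theorem: marginals of log-concave functions are log-concave. -/
theorem LogConcave.lintegral_right {E F : Type*} [AddCommGroup E] [Module ℝ E]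
    [MeasurableSpace E] [AddCommGroup F] [Module ℝ F] [MeasurableSpace F] {ρ : Measure F}
    (hρ : PrekopaLeindler ρ) {f : E × F → ℝ≥0∞} (hf : LogConcave f) (hfm : Measurable f) :
    LogConcave fun x => ∫⁻ y, f (x, y) ∂ρ := by
  intro a b ha hb hab x x'
  exact hρ ha hb hab (by fun_prop) (by fun_prop) (by fun_prop) fun y y' =>
    hf ha hb hab (x, y) (x', y')

/-- The integral over pairs of points of `K` of the kernel `|⟨x - y, a⟩|^(-p)`. -/
def differencePotential {E : Type*} [NormedAddCommGroup E] [InnerProductSpace ℝ E]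
    [MeasureSpace E] (p : ℝ) (K : Set E) (a : E) : ℝ≥0∞ :=
  ∫⁻ x in K, ∫⁻ y in K, rieszKernel p (inner ℝ (x - y) a)

/-- The marginal on the plane of the uniform density on a subset of `ℝ² × ℝᵐ`. -/
def planarMarginal {m : ℕ} (K : Set ((ℝ × ℝ) × (Fin m → ℝ))) (x : ℝ × ℝ) : ℝ≥0∞ :=
  ∫⁻ z : Fin m → ℝ, K.indicator (fun _ => 1) (x, z)

/-- The autocorrelation of the planar marginal of a subset of `ℝ² × ℝᵐ`. -/
def planarAutocorrelation {m : ℕ} (K : Set ((ℝ × ℝ) × (Fin m → ℝ))) (x : ℝ × ℝ) : ℝ≥0∞ :=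
  ∫⁻ y : ℝ × ℝ, planarMarginal K (y + x) * planarMarginal K y

theorem measurable_planarMarginal {m : ℕ} {K : Set ((ℝ × ℝ) × (Fin m → ℝ))}
    (hK : MeasurableSet K) : Measurable (planarMarginal K) :=
  Measurable.lintegral_prod_right' (f := K.indicator (fun _ => (1 : ℝ≥0∞)))
    (measurable_const.indicator hK)

theorem isSymmLogConcaveDensity_planarAutocorrelation {m : ℕ}
    {K : Set ((ℝ × ℝ) × (Fin m → ℝ))} (hconv : Convex ℝ K) (hK : IsCompact K)
    (hint : (interior K).Nonempty) : IsSymmLogConcaveDensity (planarAutocorrelation K) := by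
  set f : ℝ × ℝ → ℝ≥0∞ := planarMarginal K with hf
  have hKm : MeasurableSet K := hK.measurableSet
  have hfm : Measurable f := measurable_planarMarginal hKm
  have hflc : LogConcave f := LogConcave.lintegral_right (prekopaLeindler_pi m)
    hconv.logConcave_indicator (measurable_const.indicator hKm)
  have hF : Measurable fun q : (ℝ × ℝ) × (ℝ × ℝ) => f (q.2 + q.1) * f q.2 := by fun_prop
  obtain ⟨R, hR0, hR⟩ := hK.isBounded.exists_pos_norm_le
  have hfsupp : ∀ x, R < ‖x‖ → f x = 0 := by
    intro x hx
    refine (lintegral_congr fun z => ?_).trans lintegral_zero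
    refine indicator_of_notMem (fun hz => ?_) _
    exact absurd ((norm_fst_le (x, z)).trans (hR _ hz)) (not_le.2 hx)
  set C : ℝ≥0∞ := volume (Metric.closedBall (0 : Fin m → ℝ) R) with hC
  have hCt : C ≠ ⊤ := measure_closedBall_lt_top.ne
  have hfC : ∀ x, f x ≤ C := by
    intro x
    rw [hC, ← lintegral_indicator_one Metric.isClosed_closedBall.measurableSet]
    refine lintegral_mono fun z => ?_
    by_cases hz : (x, z) ∈ K
    · have : z ∈ Metric.closedBall (0 : Fin m → ℝ) R := by
        rw [mem_closedBall_zero_iff]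
        exact (norm_snd_le (x, z)).trans (hR _ hz)
      simp [hz, this]
    · simp [hz]
  have hfint : ∫⁻ x, f x ≠ ⊤ := by
    have : ∫⁻ x, f x = volume K := by
      rw [← lintegral_indicator_one hKm, Measure.volume_eq_prod (ℝ × ℝ),
        lintegral_prod _ (measurable_one.indicator hKm).aemeasurable]
      rfl
    rw [this]
    exact hK.measure_lt_top.ne
  obtain ⟨⟨x₀, z₀⟩, h₀⟩ := hint
  obtain ⟨δ, hδ, hball⟩ := Metric.isOpen_iff.1 isOpen_interior _ h₀
  set c : ℝ≥0∞ := volume (Metric.ball z₀ δ) with hc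
  have hc0 : c ≠ 0 := (Metric.measure_ball_pos volume z₀ hδ).ne'
  have hfc : ∀ x ∈ Metric.ball x₀ δ, c ≤ f x := by
    intro x hx
    rw [hc, ← lintegral_indicator_one Metric.isOpen_ball.measurableSet]
    refine lintegral_mono fun z => ?_
    by_cases hz : z ∈ Metric.ball z₀ δ
    · have : (x, z) ∈ K := interior_subset (hball (by
        rw [← ball_prod_same]; exact ⟨hx, hz⟩))
      simp [hz, this]
    · simp [hz]
  refine ⟨hF.lintegral_prod_right', ?_, ?_, ?_, ?_, ?_⟩
  · refine LogConcave.lintegral_right (f := fun q => f (q.2 + q.1) * f q.2)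
      (prekopaLeindler_real.prod prekopaLeindler_real) ?_ hF
    exact (hflc.comp_linearMap (LinearMap.snd ℝ _ _ + LinearMap.fst ℝ _ _)).mul
      (hflc.comp_linearMap (LinearMap.snd ℝ _ _))
  · intro x
    change ∫⁻ y, f (y + -x) * f y = ∫⁻ y, f (y + x) * f y
    rw [← lintegral_add_right_eq_self (μ := volume) (fun y => f (y + -x) * f y) x]
    simp only [add_neg_cancel_right, mul_comm]
  · refine ⟨C * ∫⁻ x, f x, ENNReal.mul_ne_top hCt hfint, fun x => ?_⟩
    rw [← lintegral_const_mul _ hfm]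
    exact lintegral_mono fun y => mul_le_mul_left (hfC _) _
  · refine ⟨2 * R, by positivity, fun x hx => (lintegral_congr fun y => ?_).trans lintegral_zero⟩
    change f (y + x) * f y = 0
    rcases lt_or_ge R ‖y‖ with h | h
    · rw [hfsupp y h, mul_zero]
    · rw [hfsupp (y + x), zero_mul]
      have := norm_sub_le (y + x) y
      rw [add_sub_cancel_left] at this
      linarith
  · refine ⟨δ / 2, by positivity, c * c * volume (Metric.ball x₀ (δ / 2)), ?_, fun x hx => ?_⟩
    · exact mul_ne_zero (mul_ne_zero hc0 hc0)
        (Metric.measure_ball_pos volume x₀ (by positivity)).ne'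
    · rw [← setLIntegral_const]
      refine le_trans (setLIntegral_mono' Metric.isOpen_ball.measurableSet fun y hy => ?_)
        (setLIntegral_le_lintegral (Metric.ball x₀ (δ / 2)) _)
      rw [Metric.mem_ball] at hy
      refine mul_le_mul' (hfc _ ?_) (hfc _ ?_) <;> rw [Metric.mem_ball]
      · rw [dist_eq_norm] at hy ⊢
        calc ‖y + x - x₀‖ = ‖(y - x₀) + x‖ := by congr 1; abel
          _ ≤ ‖y - x₀‖ + ‖x‖ := norm_add_le _ _
          _ < δ := by linarith
      · linarith

theorem planarPotential_planarAutocorrelation {m : ℕ} {K : Set ((ℝ × ℝ) × (Fin m → ℝ))}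
    (hK : MeasurableSet K) (p x y : ℝ) :
    planarPotential p (planarAutocorrelation K) x y = ∫⁻ u in K, ∫⁻ v in K,
      rieszKernel p (x * (u.1.1 - v.1.1) + y * (u.1.2 - v.1.2)) := by
  set f : ℝ × ℝ → ℝ≥0∞ := planarMarginal K with hf
  have hfm : Measurable f := measurable_planarMarginal hK
  have hmarg : ∀ F : ℝ × ℝ → ℝ≥0∞, Measurable F →
      ∫⁻ v in K, F v.1 = ∫⁻ q, f q * F q := by
    intro F hF
    rw [← lintegral_indicator hK, Measure.volume_eq_prod (ℝ × ℝ),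
      lintegral_prod (K.indicator fun v => F v.1)
        ((hF.comp measurable_fst).indicator hK).aemeasurable]
    refine lintegral_congr fun q => ?_
    have hind : Measurable fun z => K.indicator (fun _ => (1 : ℝ≥0∞)) (q, z) :=
      (measurable_const.indicator hK).comp measurable_prodMk_left
    rw [hf, planarMarginal, ← lintegral_mul_const _ hind]
    refine lintegral_congr fun z => ?_
    by_cases hz : (q, z) ∈ K <;> simp [hz]
  set k : ℝ × ℝ → ℝ≥0∞ := fun q => rieszKernel p (x * q.1 + y * q.2) with hk
  have hkm : Measurable k := by fun_prop
  have e1 : ∀ u : (ℝ × ℝ) × (Fin m → ℝ), ∫⁻ v in K,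
      rieszKernel p (x * (u.1.1 - v.1.1) + y * (u.1.2 - v.1.2)) =
      ∫⁻ q, f q * k (u.1 - q) := fun u => hmarg (fun q => k (u.1 - q)) (by fun_prop)
  rw [lintegral_congr e1]
  have hm2 : Measurable fun q' : ℝ × ℝ => ∫⁻ q, f q * k (q' - q) :=
    Measurable.lintegral_prod_right'
      (f := fun r : (ℝ × ℝ) × (ℝ × ℝ) => f r.2 * k (r.1 - r.2)) (by fun_prop)
  rw [hmarg _ hm2]
  have e2 : ∀ q', f q' * ∫⁻ q, f q * k (q' - q) = ∫⁻ q, f q' * (f q * k (q' - q)) := fun q' =>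
    (lintegral_const_mul _ (by fun_prop)).symm
  rw [lintegral_congr e2, lintegral_lintegral_swap (by fun_prop)]
  have e3 : ∀ q, ∫⁻ q', f q' * (f q * k (q' - q)) = ∫⁻ q', f (q + q') * f q * k q' := by
    intro q
    rw [← lintegral_add_right_eq_self (μ := volume) (fun q' => f q' * (f q * k (q' - q))) q]
    refine lintegral_congr fun q' => ?_
    rw [add_sub_cancel_right, add_comm q' q, mul_assoc]
  rw [lintegral_congr e3, lintegral_lintegral_swap (by fun_prop)]
  refine lintegral_congr fun q' => ?_
  have hac : Measurable fun q => f (q + q') * f q := by fun_prop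
  exact (lintegral_mul_const _ hac).symm

/-- Two linearly independent vectors are the first two coordinate functionals of some linear
coordinate system. -/
theorem exists_linearEquiv_inner {E : Type*} [NormedAddCommGroup E] [InnerProductSpace ℝ E]
    [FiniteDimensional ℝ E] {a b : E} (hab : LinearIndependent ℝ ![a, b]) :
    ∃ m : ℕ, ∃ L : E ≃ₗ[ℝ] (ℝ × ℝ) × (Fin m → ℝ),
      ∀ v, (L v).1 = (inner ℝ v a, inner ℝ v b) := by
  set T : E →ₗ[ℝ] ℝ × ℝ := (innerₗ E a).prod (innerₗ E b) with hT
  have hTa : ∀ v, T v = (inner ℝ v a, inner ℝ v b) := fun v => by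
    simp [hT, real_inner_comm]
  have hsurj : LinearMap.range T = ⊤ := by
    by_contra h
    obtain ⟨φ, hφ0, hφ⟩ := Submodule.exists_le_ker_of_lt_top _ (lt_top_iff_ne_top.2 h)
    have hφe : ∀ s t, φ (s, t) = s * φ (1, 0) + t * φ (0, 1) := by
      intro s t
      have : ((s, t) : ℝ × ℝ) = s • (1, 0) + t • (0, 1) := by simp
      rw [this, map_add, map_smul, map_smul, smul_eq_mul, smul_eq_mul]
    have hzero : φ (1, 0) • a + φ (0, 1) • b = 0 := by
      refine ext_inner_left ℝ fun v => ?_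
      have h1 : φ (T v) = 0 := hφ ⟨v, rfl⟩
      rw [hTa, hφe] at h1
      rw [inner_add_right, inner_smul_right, inner_smul_right, inner_zero_right]
      linarith
    obtain ⟨h1, h2⟩ := LinearIndependent.pair_iff.1 hab _ _ hzero
    exact hφ0 (LinearMap.ext fun q => by
      obtain ⟨s, t⟩ := q
      rw [hφe, h1, h2]; simp)
  obtain ⟨Q, hQ⟩ := Submodule.exists_isCompl (LinearMap.ker T)
  let e := LinearMap.equivProdOfSurjectiveOfIsCompl T
    (Submodule.projectionOnto (LinearMap.ker T) Q hQ) hsurj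
    (Submodule.range_projectionOnto hQ) (by rwa [Submodule.ker_projectionOnto])
  let e' := (LinearEquiv.refl ℝ (ℝ × ℝ)).prodCongr
    (Module.finBasis ℝ (LinearMap.ker T)).equivFun
  refine ⟨_, e.trans e', fun v => ?_⟩
  rw [← hTa]
  rfl

/-- Reduction to the plane: on the span of `a` and `b` the potential of `K` is that of the marginal
of its autocorrelation under `x ↦ (⟨x, a⟩, ⟨x, b⟩)`. -/
theorem exists_planarPotential_eq {E : Type*} [NormedAddCommGroup E] [InnerProductSpace ℝ E]
    [FiniteDimensional ℝ E] [MeasureSpace E] [BorelSpace E]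
    [(volume : Measure E).IsAddHaarMeasure] {K : Set E} (hconv : Convex ℝ K) (hK : IsCompact K)
    (hint : (interior K).Nonempty) {a b : E} (hab : LinearIndependent ℝ ![a, b]) :
    ∃ g : ℝ × ℝ → ℝ≥0∞, IsSymmLogConcaveDensity g ∧ ∃ C : ℝ≥0∞, ∀ p x y : ℝ,
      differencePotential p K (x • a + y • b) = C * planarPotential p g x y := by
  obtain ⟨m, L, hL⟩ := exists_linearEquiv_inner hab
  set Λ : E ≃L[ℝ] (ℝ × ℝ) × (Fin m → ℝ) := L.toContinuousLinearEquiv with hΛ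
  set K' := Λ '' K with hK'
  have hK'c : IsCompact K' := hK.image Λ.continuous
  refine ⟨planarAutocorrelation K', isSymmLogConcaveDensity_planarAutocorrelation
    (hconv.linear_image L.toLinearMap) hK'c ?_, ?_⟩
  · obtain ⟨x, hx⟩ := hint
    refine ⟨Λ x, ?_⟩
    have := Λ.toHomeomorph.image_interior K
    exact this ▸ mem_image_of_mem _ hx
  set ν : Measure ((ℝ × ℝ) × (Fin m → ℝ)) := Measure.map Λ volume with hν
  have : (volume : Measure ((ℝ × ℝ) × (Fin m → ℝ))).IsAddHaarMeasure :=
    Measure.prod.instIsAddHaarMeasure _ _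
  obtain ⟨c, hc⟩ : ∃ c : NNReal, ν = c • volume :=
    ⟨_, Measure.isAddLeftInvariant_eq_smul ν volume⟩
  have hpre : Λ ⁻¹' K' = K := preimage_image_eq _ Λ.injective
  have hcv : ∀ F : (ℝ × ℝ) × (Fin m → ℝ) → ℝ≥0∞, Measurable F →
      ∫⁻ v in K, F (Λ v) = (c : ℝ≥0∞) * ∫⁻ u in K', F u := by
    intro F hF
    rw [← smul_eq_mul, ← lintegral_smul_measure, ← Measure.restrict_smul, ← ENNReal.smul_def,
      ← hc, hν,
      setLIntegral_map hK'c.measurableSet hF Λ.continuous.measurable, hpre]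
  refine ⟨c * c, fun p x y => ?_⟩
  rw [planarPotential_planarAutocorrelation hK'c.measurableSet, differencePotential]
  have e1 : ∀ u v : E, rieszKernel p (inner ℝ (u - v) (x • a + y • b)) =
      rieszKernel p (x * ((Λ u).1.1 - (Λ v).1.1) + y * ((Λ u).1.2 - (Λ v).1.2)) := by
    intro u v
    have hu : (Λ u).1 = (inner ℝ u a, inner ℝ u b) := hL u
    have hv : (Λ v).1 = (inner ℝ v a, inner ℝ v b) := hL v
    rw [hu, hv, inner_add_right, inner_smul_right, inner_smul_right, inner_sub_left,
      inner_sub_left]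
  have e2 : ∀ u : E, ∫⁻ v in K, rieszKernel p (inner ℝ (u - v) (x • a + y • b)) =
      c * ∫⁻ w in K', rieszKernel p (x * ((Λ u).1.1 - w.1.1) + y * ((Λ u).1.2 - w.1.2)) := by
    intro u
    rw [← hcv (fun w => rieszKernel p (x * ((Λ u).1.1 - w.1.1) + y * ((Λ u).1.2 - w.1.2)))
      (by fun_prop)]
    exact lintegral_congr fun v => e1 u v
  have hm : Measurable fun u : (ℝ × ℝ) × (Fin m → ℝ) =>
      ∫⁻ w in K', rieszKernel p (x * (u.1.1 - w.1.1) + y * (u.1.2 - w.1.2)) :=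
    Measurable.lintegral_prod_right'
      (f := fun r : ((ℝ × ℝ) × (Fin m → ℝ)) × ((ℝ × ℝ) × (Fin m → ℝ)) =>
        rieszKernel p (x * (r.1.1.1 - r.2.1.1) + y * (r.1.1.2 - r.2.1.2))) (by fun_prop)
  rw [lintegral_congr e2, hcv _ (hm.const_mul c), lintegral_const_mul _ hm, mul_assoc]

/-! ### Fourier moments as potentials -/

section FourierSide

open Filter Topology

variable {n : ℕ} {K : Set (EuclideanSpace ℝ (Fin n))}

theorem fourierTransform_charIndicator (hK : MeasurableSet K) (y : EuclideanSpace ℝ (Fin n)) :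
    fourierTransform (charIndicator K) y =
      ∫ x in K, Complex.exp (-Complex.I * ((inner ℝ x y : ℝ) : ℂ)) := by
  rw [fourierTransform, ← integral_indicator hK]
  refine integral_congr_ae (Eventually.of_forall fun x => ?_)
  by_cases hx : x ∈ K <;> simp [charIndicator, hx]

theorem norm_exp_neg_I_mul (t : ℝ) : ‖Complex.exp (-Complex.I * (t : ℂ))‖ = 1 := by
  rw [neg_mul, mul_comm, ← neg_mul, ← Complex.ofReal_neg, Complex.norm_exp_ofReal_mul_I]

theorem continuous_fourierTransform_charIndicator (hK : IsCompact K) :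
    Continuous (fourierTransform (charIndicator K)) := by
  have hfin : IsFiniteMeasure (volume.restrict K) := isFiniteMeasure_restrict.2 hK.measure_ne_top
  rw [funext (fourierTransform_charIndicator hK.measurableSet)]
  refine continuous_of_dominated (bound := fun _ => 1) (fun y => ?_) (fun y => ?_)
    (integrable_const _) ?_
  · exact Continuous.aestronglyMeasurable (by fun_prop)
  · exact Eventually.of_forall fun x => (norm_exp_neg_I_mul _).le
  · exact Eventually.of_forall fun x => by fun_prop

theorem norm_fourierTransform_charIndicator_le (hK : IsCompact K)
    (y : EuclideanSpace ℝ (Fin n)) :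
    ‖fourierTransform (charIndicator K) y‖ ≤ volume.real K := by
  have hfin : IsFiniteMeasure (volume.restrict K) := isFiniteMeasure_restrict.2 hK.measure_ne_top
  rw [fourierTransform_charIndicator hK.measurableSet]
  refine (norm_integral_le_of_norm_le_const (C := 1)
    (Eventually.of_forall fun x => (norm_exp_neg_I_mul _).le)).trans (le_of_eq ?_)
  simp

/-- `|χ̂_K|²` is the Fourier transform of the autocorrelation of `χ_K`. -/
theorem norm_sq_fourierTransform_charIndicator (hK : IsCompact K)
    (y : EuclideanSpace ℝ (Fin n)) :
    ((‖fourierTransform (charIndicator K) y‖ ^ 2 : ℝ) : ℂ) =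
      ∫ z, Complex.exp (-Complex.I * ((inner ℝ (z.1 - z.2) y : ℝ) : ℂ))
        ∂((volume.restrict K).prod (volume.restrict K)) := by
  have h := Complex.mul_conj' (fourierTransform (charIndicator K) y)
  push_cast
  rw [← h, fourierTransform_charIndicator hK.measurableSet, ← integral_conj,
    ← integral_prod_mul]
  refine integral_congr_ae (Eventually.of_forall fun z => ?_)
  simp only
  rw [← Complex.exp_conj, ← Complex.exp_add, inner_sub_left]
  congr 1
  simp
  ring

/-- The Laplace transform of `r ↦ |χ̂_K(ra)|²` is the integral of a Poisson kernel over pairs of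
points of `K`. -/
theorem integral_exp_mul_norm_sq_fourierTransform (hK : IsCompact K) {s : ℝ} (hs : 0 < s)
    (a : EuclideanSpace ℝ (Fin n)) :
    ∫ r in Ioi (0 : ℝ), Real.exp (-s * r) * ‖fourierTransform (charIndicator K) (r • a)‖ ^ 2 =
      ∫ z, s / (s ^ 2 + inner ℝ (z.1 - z.2) a ^ 2)
        ∂((volume.restrict K).prod (volume.restrict K)) := by
  have hfin : IsFiniteMeasure (volume.restrict K) := isFiniteMeasure_restrict.2 hK.measure_ne_top
  set μ := (volume.restrict K).prod (volume.restrict K) with hμ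
  set u : EuclideanSpace ℝ (Fin n) × EuclideanSpace ℝ (Fin n) → ℝ :=
    fun z => inner ℝ (z.1 - z.2) a with hu
  have hum : Continuous u := by fun_prop
  have hwint : IntegrableOn (fun r : ℝ => Real.exp (-s * r)) (Ioi 0) :=
    integrableOn_exp_mul_Ioi (by linarith) 0
  have hcint : Integrable (fun q : ℝ × (EuclideanSpace ℝ (Fin n) × EuclideanSpace ℝ (Fin n)) =>
      ((Real.exp (-s * q.1) : ℝ) : ℂ) * Complex.exp (-Complex.I * ((q.1 * u q.2 : ℝ) : ℂ)))
      ((volume.restrict (Ioi 0)).prod μ) := by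
    have h1 : Integrable (fun q : ℝ × (EuclideanSpace ℝ (Fin n) × EuclideanSpace ℝ (Fin n)) =>
        Real.exp (-s * q.1) * (1 : ℝ))
        ((volume.restrict (Ioi 0)).prod μ) := hwint.mul_prod (integrable_const (1 : ℝ))
    refine h1.mono (Measurable.aestronglyMeasurable (by fun_prop)) ?_
    refine Eventually.of_forall fun q => le_of_eq ?_
    rw [norm_mul, norm_exp_neg_I_mul, mul_one, mul_one, Complex.norm_real]
  have hinner : ∀ z, ∫ r in Ioi (0 : ℝ), ((Real.exp (-s * r) : ℝ) : ℂ) *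
      Complex.exp (-Complex.I * ((r * u z : ℝ) : ℂ)) = 1 / ((s : ℂ) + Complex.I * u z) := by
    intro z
    have := integral_exp_mul_complex_Ioi (a := -((s : ℂ) + Complex.I * u z)) (by simpa using hs) 0
    simp only [Complex.ofReal_zero, mul_zero, Complex.exp_zero, neg_div_neg_eq] at this
    rw [← this]
    refine setIntegral_congr_fun measurableSet_Ioi fun r _ => ?_
    push_cast
    rw [← Complex.exp_add]
    congr 1
    ring
  have hC : ((∫ r in Ioi (0 : ℝ), Real.exp (-s * r) *
        ‖fourierTransform (charIndicator K) (r • a)‖ ^ 2 : ℝ) : ℂ) =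
      ∫ z, 1 / ((s : ℂ) + Complex.I * u z) ∂μ := by
    rw [← integral_complex_ofReal, ← integral_congr_ae (Eventually.of_forall hinner),
      ← integral_integral_swap hcint]
    refine integral_congr_ae (Eventually.of_forall fun r => ?_)
    simp only
    rw [integral_const_mul, Complex.ofReal_mul, norm_sq_fourierTransform_charIndicator hK]
    congr 1
    refine integral_congr_ae (Eventually.of_forall fun z => ?_)
    simp only [hu, inner_smul_right]
  have hint2 : Integrable (fun z => 1 / ((s : ℂ) + Complex.I * u z)) μ :=
    hcint.integral_prod_right.congr (Eventually.of_forall hinner)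
  have hre := congrArg Complex.re hC
  rw [Complex.ofReal_re] at hre
  rw [hre, ← Complex.reCLM_apply, ← ContinuousLinearMap.integral_comp_comm _ hint2]
  refine integral_congr_ae (Eventually.of_forall fun z => ?_)
  simp only [Complex.reCLM_apply]
  rw [one_div, Complex.inv_re, Complex.normSq_apply]
  simp [sq, hu]

theorem lintegral_exp_mul_norm_sq_fourierTransform (hK : IsCompact K) {s : ℝ} (hs : 0 < s)
    (a : EuclideanSpace ℝ (Fin n)) :
    ∫⁻ r in Ioi (0 : ℝ), ENNReal.ofReal (Real.exp (-s * r)) *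
        ENNReal.ofReal (‖fourierTransform (charIndicator K) (r • a)‖ ^ 2) =
      ∫⁻ x in K, ∫⁻ y in K, ENNReal.ofReal (s / (s ^ 2 + inner ℝ (x - y) a ^ 2)) := by
  have hfin : IsFiniteMeasure (volume.restrict K) := isFiniteMeasure_restrict.2 hK.measure_ne_top
  have hcont := continuous_fourierTransform_charIndicator hK
  have hi1 : IntegrableOn (fun r : ℝ => Real.exp (-s * r) *
      ‖fourierTransform (charIndicator K) (r • a)‖ ^ 2) (Ioi 0) := by
    refine Integrable.mul_bdd (c := volume.real K ^ 2) (integrableOn_exp_mul_Ioi (by linarith) 0)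
      (Continuous.aestronglyMeasurable (by fun_prop)) (Eventually.of_forall fun r => ?_)
    rw [norm_pow, norm_norm]
    gcongr
    exact norm_fourierTransform_charIndicator_le hK _
  have hi2 : Integrable (fun z : EuclideanSpace ℝ (Fin n) × EuclideanSpace ℝ (Fin n) =>
      s / (s ^ 2 + inner ℝ (z.1 - z.2) a ^ 2))
      ((volume.restrict K).prod (volume.restrict K)) := by
    refine Integrable.mono' (integrable_const s⁻¹) (Measurable.aestronglyMeasurable (by fun_prop))
      (Eventually.of_forall fun z => ?_)
    rw [Real.norm_of_nonneg (by positivity), div_le_iff₀ (by positivity), inv_mul_eq_div,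
      le_div_iff₀ hs]
    nlinarith [sq_nonneg (inner ℝ (z.1 - z.2) a : ℝ)]
  have h := integral_exp_mul_norm_sq_fourierTransform hK hs a
  have h1 := ofReal_integral_eq_lintegral_ofReal hi1
    (Eventually.of_forall fun r => by positivity)
  have h2 := ofReal_integral_eq_lintegral_ofReal hi2
    (Eventually.of_forall fun z => by positivity)
  rw [h, h2, lintegral_prod _ (by fun_prop)] at h1
  rw [h1]
  refine lintegral_congr fun r => ?_
  rw [ENNReal.ofReal_mul (Real.exp_pos _).le]

/-- The Fourier moment `∫₀^∞ |χ̂_K(ra)|² r^(p-1) dr`. -/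
def fourierMoment (p : ℝ) (K : Set (EuclideanSpace ℝ (Fin n)))
    (a : EuclideanSpace ℝ (Fin n)) : ℝ≥0∞ :=
  radialMoment p (fun y => ENNReal.ofReal (‖fourierTransform (charIndicator K) y‖ ^ 2)) a

theorem lintegral_Ioi_eq_mul_lintegral_comp_mul {G : ℝ → ℝ≥0∞} (hG : Measurable G) {c : ℝ}
    (hc : 0 < c) :
    ∫⁻ t in Ioi (0 : ℝ), G t = ENNReal.ofReal c * ∫⁻ t in Ioi (0 : ℝ), G (c * t) := by
  rw [← lintegral_indicator measurableSet_Ioi, ← lintegral_indicator measurableSet_Ioi,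
    lintegral_eq_abs_mul_lintegral_comp_mul (hG.indicator measurableSet_Ioi) hc.ne',
    abs_of_pos hc]
  congr 1
  refine lintegral_congr fun t => ?_
  by_cases ht : 0 < t
  · simp [ht, mul_pos hc ht]
  · have : ¬ 0 < c * t := fun h => ht (pos_of_mul_pos_right h hc.le)
    simp [ht, this]

/-- A superposition of Poisson kernels is a multiple of the Riesz kernel. -/
theorem exists_lintegral_poisson_eq {p : ℝ} (hp : 0 < p) :
    ∃ c : ℝ≥0∞, ∀ u : ℝ, ∫⁻ s in Ioi (0 : ℝ), ENNReal.ofReal (s ^ (-p)) *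
      ENNReal.ofReal (s / (s ^ 2 + u ^ 2)) = c * rieszKernel p u := by
  set I : ℝ → ℝ≥0∞ := fun u => ∫⁻ s in Ioi (0 : ℝ), ENNReal.ofReal (s ^ (-p)) *
      ENNReal.ofReal (s / (s ^ 2 + u ^ 2)) with hI
  have hne : ∀ u, u ≠ 0 → I u = I 1 * rieszKernel p u := by
    intro u hu
    have hu' : 0 < |u| := abs_pos.2 hu
    simp only [hI]
    rw [lintegral_Ioi_eq_mul_lintegral_comp_mul (by fun_prop) hu', rieszKernel,
      ENNReal.ofReal_rpow_of_pos hu', ← lintegral_mul_const' _ _ ENNReal.ofReal_ne_top,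
      ← lintegral_const_mul' _ _ ENNReal.ofReal_ne_top]
    refine setLIntegral_congr_fun measurableSet_Ioi fun t ht => ?_
    have ht : 0 < t := ht
    rw [← ENNReal.ofReal_mul (by positivity), ← ENNReal.ofReal_mul (by positivity),
      ← ENNReal.ofReal_mul (by positivity), ← ENNReal.ofReal_mul (by positivity)]
    congr 1
    rw [Real.mul_rpow hu'.le ht.le, mul_pow, ← sq_abs u]
    field_simp
  have h1 : I 1 ≠ 0 := by
    simp only [hI]
    intro h
    rw [lintegral_eq_zero_iff (by fun_prop)] at h
    have h2 : ∀ᵐ t ∂(volume.restrict (Ioi (0 : ℝ))), t ∉ Ioi (0 : ℝ) := by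
      filter_upwards [h] with t ht hmem
      have hmem : 0 < t := hmem
      simp only [Pi.zero_apply, mul_eq_zero, ENNReal.ofReal_eq_zero] at ht
      rcases ht with ht | ht
      · exact absurd ht (not_le.2 (by positivity))
      · exact absurd ht (not_le.2 (by positivity))
    rw [ae_iff] at h2
    simp only [not_not, ofPred_mem_eq] at h2
    rw [Measure.restrict_apply measurableSet_Ioi, inter_self, Real.volume_Ioi] at h2
    exact ENNReal.top_ne_zero h2
  refine ⟨I 1, fun u => ?_⟩
  rcases eq_or_ne u 0 with rfl | hu
  · have hv : rieszKernel p 0 = ⊤ := by simp [rieszKernel, hp]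
    refine le_antisymm (by rw [hv, ENNReal.mul_top h1]; exact le_top) ?_
    -- the left side at `0` dominates its values at `u ≠ 0`, which tend to infinity
    have hlim : Tendsto (fun u => I 1 * rieszKernel p u) (𝓝[≠] 0)
        (𝓝 (I 1 * rieszKernel p 0)) :=
      ENNReal.Tendsto.const_mul (((continuous_rieszKernel p).tendsto 0).mono_left
        nhdsWithin_le_nhds) (.inl (by rw [hv]; exact ENNReal.top_ne_zero))
    refine le_of_tendsto hlim ?_
    filter_upwards [self_mem_nhdsWithin] with u hu
    rw [← hne u hu]
    refine setLIntegral_mono' measurableSet_Ioi fun t ht => ?_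
    have ht : 0 < t := ht
    exact mul_le_mul_right (ENNReal.ofReal_le_ofReal (div_le_div_of_nonneg_left ht.le
      (by positivity) (by simpa using sq_nonneg u))) _
  · exact hne u hu

/-- For `0 < p < 1` the Fourier moments are potentials of the autocorrelation of `χ_K`: write
`r^(p-1)` as a superposition of exponentials and apply the Laplace transform formula. -/
theorem exists_fourierMoment_eq {p : ℝ} (hp : 0 < p) (hp1 : p < 1) :
    ∃ c : ℝ≥0∞, ∀ K : Set (EuclideanSpace ℝ (Fin n)), IsCompact K → ∀ a,
      fourierMoment p K a = c * differencePotential p K a := by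
  obtain ⟨c, hc⟩ := exists_lintegral_poisson_eq hp
  have hG : 0 < Real.Gamma (1 - p) := Real.Gamma_pos_of_pos (by linarith)
  have hG0 : ENNReal.ofReal (Real.Gamma (1 - p)) ≠ 0 := by simpa using hG
  refine ⟨(ENNReal.ofReal (Real.Gamma (1 - p)))⁻¹ * c, fun K hK a => ?_⟩
  have hcont := continuous_fourierTransform_charIndicator hK
  have hfin : IsFiniteMeasure (volume.restrict K) := isFiniteMeasure_restrict.2 hK.measure_ne_top
  have hexp : ∀ r : ℝ, 0 < r → ENNReal.ofReal (Real.Gamma (1 - p)) * ENNReal.ofReal (r ^ (p - 1)) =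
      ∫⁻ s in Ioi (0 : ℝ), ENNReal.ofReal (s ^ (-p)) * ENNReal.ofReal (Real.exp (-s * r)) := by
    intro r hr
    have h1 := Real.integral_rpow_mul_exp_neg_mul_Ioi (a := 1 - p) (r := r) (by linarith) hr
    have h2 : IntegrableOn (fun s : ℝ => s ^ (1 - p - 1) * Real.exp (-(r * s))) (Ioi 0) := by
      have := integrableOn_rpow_mul_exp_neg_mul_rpow (s := 1 - p - 1) (p := 1) (b := r)
        (by linarith) one_pos hr
      simpa using this
    have h3 := ofReal_integral_eq_lintegral_ofReal h2 (by
      filter_upwards [self_mem_ae_restrict measurableSet_Ioi] with s hs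
      have hs : 0 < s := hs
      simp only [Pi.zero_apply]
      positivity)
    rw [h1] at h3
    rw [← ENNReal.ofReal_mul hG.le]
    have e : Real.Gamma (1 - p) * r ^ (p - 1) = (1 / r) ^ (1 - p) * Real.Gamma (1 - p) := by
      rw [one_div, Real.inv_rpow hr.le, ← Real.rpow_neg hr.le, neg_sub, mul_comm]
    rw [e, h3]
    refine setLIntegral_congr_fun measurableSet_Ioi fun s hs => ?_
    have hs : 0 < s := hs
    rw [← ENNReal.ofReal_mul (by positivity)]
    congr 3
    · ring
    · ring
  have hmain : ENNReal.ofReal (Real.Gamma (1 - p)) * fourierMoment p K a =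
      c * differencePotential p K a := by
    calc ENNReal.ofReal (Real.Gamma (1 - p)) * fourierMoment p K a
        = ∫⁻ r in Ioi (0 : ℝ), ∫⁻ s in Ioi (0 : ℝ), ENNReal.ofReal (s ^ (-p)) *
            (ENNReal.ofReal (Real.exp (-s * r)) *
              ENNReal.ofReal (‖fourierTransform (charIndicator K) (r • a)‖ ^ 2)) := by
          rw [fourierMoment, radialMoment, ← lintegral_const_mul' _ _ ENNReal.ofReal_ne_top]
          refine setLIntegral_congr_fun measurableSet_Ioi fun r hr => ?_
          rw [← mul_assoc, hexp r hr, ← lintegral_mul_const' _ _ ENNReal.ofReal_ne_top]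
          exact lintegral_congr fun s => mul_assoc _ _ _
      _ = ∫⁻ s in Ioi (0 : ℝ), ENNReal.ofReal (s ^ (-p)) *
            ∫⁻ x in K, ∫⁻ y in K, ENNReal.ofReal (s / (s ^ 2 + inner ℝ (x - y) a ^ 2)) := by
          rw [lintegral_lintegral_swap (Measurable.aemeasurable (by
            simp only [Function.uncurry_def]; fun_prop))]
          refine setLIntegral_congr_fun measurableSet_Ioi fun s hs => ?_
          rw [← lintegral_exp_mul_norm_sq_fourierTransform hK hs,
            lintegral_const_mul' _ _ ENNReal.ofReal_ne_top]
      _ = ∫⁻ x in K, ∫⁻ y in K, ∫⁻ s in Ioi (0 : ℝ), ENNReal.ofReal (s ^ (-p)) *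
            ENNReal.ofReal (s / (s ^ 2 + inner ℝ (x - y) a ^ 2)) := by
          have hF : Measurable fun q : (EuclideanSpace ℝ (Fin n) × EuclideanSpace ℝ (Fin n)) × ℝ =>
              ENNReal.ofReal (q.2 ^ (-p)) *
                ENNReal.ofReal (q.2 / (q.2 ^ 2 + inner ℝ (q.1.1 - q.1.2) a ^ 2)) := by fun_prop
          rw [← lintegral_prod (fun z : EuclideanSpace ℝ (Fin n) × EuclideanSpace ℝ (Fin n) =>
              ∫⁻ s in Ioi (0 : ℝ), ENNReal.ofReal (s ^ (-p)) *
                ENNReal.ofReal (s / (s ^ 2 + inner ℝ (z.1 - z.2) a ^ 2)))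
            hF.lintegral_prod_right'.aemeasurable,
            lintegral_lintegral_swap hF.aemeasurable]
          refine lintegral_congr fun s => ?_
          rw [lintegral_const_mul' _ _ ENNReal.ofReal_ne_top, lintegral_prod _ (by fun_prop)]
      _ = c * differencePotential p K a := by
          simp only [hc]
          have hF : Measurable fun q : EuclideanSpace ℝ (Fin n) × EuclideanSpace ℝ (Fin n) =>
              rieszKernel p (inner ℝ (q.1 - q.2) a) := by fun_prop
          rw [differencePotential, ← lintegral_const_mul _ hF.lintegral_prod_right']
          refine lintegral_congr fun x => ?_
          rw [lintegral_const_mul _ (by fun_prop)]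
  rw [mul_assoc, ← hmain, ← mul_assoc, ENNReal.inv_mul_cancel hG0 ENNReal.ofReal_ne_top, one_mul]

end FourierSide

/-! ### The gauge of the Fourier mean body -/

section FourierGauge

open Filter Topology

variable {n : ℕ} {K : Set (EuclideanSpace ℝ (Fin n))}

theorem lintegral_comp_add_mul (ψ : ℝ → ℝ≥0∞) (hψ : Measurable ψ) (c : ℝ) {A : ℝ} (hA : 0 < A) :
    ∫⁻ t, ψ (c + t * A) = ENNReal.ofReal A⁻¹ * ∫⁻ t, ψ t := by
  rw [← lintegral_add_left_eq_self (μ := volume) ψ c,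
    lintegral_eq_abs_mul_lintegral_comp_mul (G := fun t => ψ (c + t)) (by fun_prop) hA.ne',
    ← mul_assoc, abs_of_pos hA, ← ENNReal.ofReal_mul (by positivity), inv_mul_cancel₀ hA.ne',
    ENNReal.ofReal_one, one_mul]
  simp only [mul_comm A]

/-- The integral of a ridge function over a bounded set is controlled by the integral of its
profile: average over the translations by `τ a`, `0 ≤ τ ≤ 1`. -/
theorem setLIntegral_comp_inner_le {R : ℝ} (hK : MeasurableSet K)
    (hR : K ⊆ Metric.closedBall 0 R) {a : EuclideanSpace ℝ (Fin n)} (ha : a ≠ 0) {ψ : ℝ → ℝ≥0∞}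
    (hψ : Measurable ψ) :
    ∫⁻ y in K, ψ (inner ℝ y a) ≤
      ENNReal.ofReal (‖a‖ ^ 2)⁻¹ * (∫⁻ t, ψ t) *
        volume (Metric.closedBall (0 : EuclideanSpace ℝ (Fin n)) (R + ‖a‖)) := by
  set B := Metric.closedBall (0 : EuclideanSpace ℝ (Fin n)) (R + ‖a‖) with hB
  have hBm : MeasurableSet B := Metric.isClosed_closedBall.measurableSet
  have ha' : 0 < ‖a‖ ^ 2 := by have := norm_pos_iff.2 ha; positivity
  have hτ : ∀ τ ∈ Icc (0 : ℝ) 1, ∫⁻ y in K, ψ (inner ℝ y a) ≤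
      ∫⁻ y in B, ψ (inner ℝ y a + τ * ‖a‖ ^ 2) := by
    intro τ hτ
    rw [← lintegral_indicator hK, ← lintegral_indicator hBm,
      ← lintegral_add_right_eq_self (μ := volume) _ (τ • a)]
    refine lintegral_mono fun y => ?_
    by_cases hy : y + τ • a ∈ K
    · have hyB : y ∈ B := by
        have h1 := hR hy
        rw [mem_closedBall_zero_iff] at h1
        rw [hB, mem_closedBall_zero_iff]
        have h2 : ‖τ • a‖ ≤ ‖a‖ := by
          rw [norm_smul, Real.norm_of_nonneg hτ.1]
          exact mul_le_of_le_one_left (norm_nonneg a) hτ.2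
        have h3 := norm_sub_le (y + τ • a) (τ • a)
        rw [add_sub_cancel_right] at h3
        linarith
      rw [indicator_of_mem hy, indicator_of_mem hyB, inner_add_left, inner_smul_left,
        real_inner_self_eq_norm_sq]
      simp
    · rw [indicator_of_notMem hy]
      exact bot_le
  calc ∫⁻ y in K, ψ (inner ℝ y a)
      = ∫⁻ _ in Icc (0 : ℝ) 1, ∫⁻ y in K, ψ (inner ℝ y a) := by simp
    _ ≤ ∫⁻ τ in Icc (0 : ℝ) 1, ∫⁻ y in B, ψ (inner ℝ y a + τ * ‖a‖ ^ 2) :=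
        setLIntegral_mono' measurableSet_Icc hτ
    _ = ∫⁻ y in B, ∫⁻ τ in Icc (0 : ℝ) 1, ψ (inner ℝ y a + τ * ‖a‖ ^ 2) :=
        lintegral_lintegral_swap (Measurable.aemeasurable (by
          simp only [Function.uncurry_def]; fun_prop))
    _ ≤ ∫⁻ _ in B, ENNReal.ofReal (‖a‖ ^ 2)⁻¹ * ∫⁻ t, ψ t := by
        refine lintegral_mono fun y => (setLIntegral_le_lintegral _ _).trans (le_of_eq ?_)
        exact lintegral_comp_add_mul ψ hψ _ ha'
    _ = _ := by rw [setLIntegral_const]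

theorem lintegral_poisson {s : ℝ} (hs : 0 < s) :
    ∫⁻ t : ℝ, ENNReal.ofReal (s / (s ^ 2 + t ^ 2)) = ENNReal.ofReal Real.pi := by
  rw [lintegral_eq_abs_mul_lintegral_comp_mul (by fun_prop) hs.ne', abs_of_pos hs,
    ← lintegral_const_mul' _ _ ENNReal.ofReal_ne_top, ← integral_univ_inv_one_add_sq,
    ofReal_integral_eq_lintegral_ofReal integrable_inv_one_add_sq
      (Eventually.of_forall fun t => by positivity)]
  refine lintegral_congr fun t => ?_
  rw [← ENNReal.ofReal_mul hs.le]
  congr 1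
  field_simp

theorem fourierMoment_one_ne_top (hK : IsCompact K) {a : EuclideanSpace ℝ (Fin n)}
    (ha : a ≠ 0) : fourierMoment 1 K a ≠ ⊤ := by
  have hcont := continuous_fourierTransform_charIndicator hK
  obtain ⟨R, hR⟩ := hK.isBounded.subset_closedBall (0 : EuclideanSpace ℝ (Fin n))
  set C : ℝ≥0∞ := ENNReal.ofReal (‖a‖ ^ 2)⁻¹ * ENNReal.ofReal Real.pi *
    volume (Metric.closedBall (0 : EuclideanSpace ℝ (Fin n)) (R + ‖a‖)) * volume K with hC
  have hCt : C ≠ ⊤ := ENNReal.mul_ne_top (ENNReal.mul_ne_top (ENNReal.mul_ne_top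
    ENNReal.ofReal_ne_top ENNReal.ofReal_ne_top) measure_closedBall_lt_top.ne) hK.measure_ne_top
  have hbd : ∀ s : ℝ, 0 < s → ∫⁻ r in Ioi (0 : ℝ), ENNReal.ofReal (Real.exp (-s * r)) *
      ENNReal.ofReal (‖fourierTransform (charIndicator K) (r • a)‖ ^ 2) ≤ C := by
    intro s hs
    rw [lintegral_exp_mul_norm_sq_fourierTransform hK hs, hC, ← setLIntegral_const]
    refine lintegral_mono fun x => ?_
    have h := setLIntegral_comp_inner_le hK.measurableSet hR ha
      (ψ := fun t => ENNReal.ofReal (s / (s ^ 2 + (inner ℝ x a - t) ^ 2))) (by fun_prop)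
    rw [lintegral_sub_left_eq_self (μ := volume)
      (fun t : ℝ => ENNReal.ofReal (s / (s ^ 2 + t ^ 2))), lintegral_poisson hs] at h
    simpa only [inner_sub_left] using h
  refine ne_top_of_le_ne_top hCt ?_
  have hlim : ∀ r : ℝ, liminf (fun s : ℝ => ENNReal.ofReal (Real.exp (-s * r)) *
      ENNReal.ofReal (‖fourierTransform (charIndicator K) (r • a)‖ ^ 2)) (𝓝[>] 0) =
      ENNReal.ofReal (‖fourierTransform (charIndicator K) (r • a)‖ ^ 2) := by
    intro r
    refine Tendsto.liminf_eq ?_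
    have h1 : Tendsto (fun s : ℝ => ENNReal.ofReal (Real.exp (-s * r))) (𝓝[>] 0)
        (𝓝 (ENNReal.ofReal (Real.exp (-0 * r)))) :=
      Tendsto.mono_left
          ((ENNReal.continuous_ofReal.comp (by fun_prop)).tendsto 0) nhdsWithin_le_nhds
    have h2 := ENNReal.Tendsto.mul_const (b :=
      ENNReal.ofReal (‖fourierTransform (charIndicator K) (r • a)‖ ^ 2)) h1
      (.inr ENNReal.ofReal_ne_top)
    simpa using h2
  calc fourierMoment 1 K a
      = ∫⁻ r in Ioi (0 : ℝ), liminf (fun s : ℝ => ENNReal.ofReal (Real.exp (-s * r)) *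
          ENNReal.ofReal (‖fourierTransform (charIndicator K) (r • a)‖ ^ 2)) (𝓝[>] 0) := by
        rw [fourierMoment, radialMoment]
        refine lintegral_congr fun r => ?_
        rw [hlim, sub_self, Real.rpow_zero, ENNReal.ofReal_one, one_mul]
    _ ≤ liminf (fun s : ℝ => ∫⁻ r in Ioi (0 : ℝ), ENNReal.ofReal (Real.exp (-s * r)) *
          ENNReal.ofReal (‖fourierTransform (charIndicator K) (r • a)‖ ^ 2)) (𝓝[>] 0) :=
        lintegral_liminf_le fun s => by fun_prop
    _ ≤ liminf (fun _ : ℝ => C) (𝓝[>] (0 : ℝ)) := by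
        refine liminf_le_liminf ?_
        filter_upwards [self_mem_nhdsWithin] with s hs using hbd s hs
    _ = C := liminf_const C

theorem rpow_sub_one_le {p q r : ℝ} (hqp : q ≤ p) (hp1 : p ≤ 1) (hr : 0 < r) :
    ENNReal.ofReal (r ^ (p - 1)) ≤ ENNReal.ofReal (r ^ (q - 1)) + 1 := by
  rcases le_total r 1 with h | h
  · exact (ENNReal.ofReal_le_ofReal
      (Real.rpow_le_rpow_of_exponent_ge hr h (by linarith))).trans le_self_add
  · refine le_trans ?_ le_add_self
    rw [← ENNReal.ofReal_one]
    exact ENNReal.ofReal_le_ofReal (Real.rpow_le_one_of_one_le_of_nonpos h (by linarith))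

theorem fourierMoment_ne_top (hK : IsCompact K) {p : ℝ} (hp : 0 < p) (hp1 : p ≤ 1)
    {a : EuclideanSpace ℝ (Fin n)} (ha : a ≠ 0) : fourierMoment p K a ≠ ⊤ := by
  have hcont := continuous_fourierTransform_charIndicator hK
  have h1 := fourierMoment_one_ne_top hK ha
  set D : ℝ≥0∞ := ENNReal.ofReal (volume.real K ^ 2)
  have hi : ∫⁻ r in Ioc (0 : ℝ) 1, ENNReal.ofReal (r ^ (p - 1)) ≠ ⊤ := by
    have h2 : IntegrableOn (fun r : ℝ => r ^ (p - 1)) (Ioc 0 1) :=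
      (intervalIntegrable_iff_integrableOn_Ioc_of_le zero_le_one).1
        (intervalIntegral.intervalIntegrable_rpow' (by linarith))
    have h3 := ofReal_integral_eq_lintegral_ofReal h2 (by
      filter_upwards [self_mem_ae_restrict measurableSet_Ioc] with r hr
      exact Real.rpow_nonneg hr.1.le _)
    rw [← h3]
    exact ENNReal.ofReal_ne_top
  have hle : fourierMoment p K a ≤
      (∫⁻ r in Ioc (0 : ℝ) 1, ENNReal.ofReal (r ^ (p - 1)) * D) + fourierMoment 1 K a := by
    rw [fourierMoment, radialMoment, ← Ioc_union_Ioi_eq_Ioi (zero_le_one' ℝ)]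
    refine (lintegral_union_le _ _ _).trans (add_le_add ?_ ?_)
    · refine lintegral_mono fun r => ?_
      exact mul_le_mul_right (ENNReal.ofReal_le_ofReal (pow_le_pow_left₀ (norm_nonneg _)
        (norm_fourierTransform_charIndicator_le hK _) 2)) _
    · rw [fourierMoment, radialMoment]
      refine le_trans ?_ (lintegral_mono_set (Ioi_subset_Ioi (zero_le_one' ℝ)))
      refine setLIntegral_mono' measurableSet_Ioi fun r hr => ?_
      have hr : 1 < r := hr
      gcongr
      exact hr.le
  refine ne_top_of_le_ne_top ?_ hle
  rw [lintegral_mul_const' _ _ ENNReal.ofReal_ne_top]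
  exact ENNReal.add_ne_top.2 ⟨ENNReal.mul_ne_top hi ENNReal.ofReal_ne_top, h1⟩

theorem measure_real_pos_of_convexBody (hK : IsConvexBody K) : 0 < volume.real K := by
  refine ENNReal.toReal_pos ?_ hK.isCompact.measure_ne_top
  exact (Measure.measure_pos_of_nonempty_interior _ hK.nonempty_interior).ne'

theorem fourierMoment_ne_zero (hK : IsConvexBody K) (p : ℝ) (a : EuclideanSpace ℝ (Fin n)) :
    fourierMoment p K a ≠ 0 := by
  have hcont := continuous_fourierTransform_charIndicator hK.isCompact
  have h0 : fourierTransform (charIndicator K) 0 ≠ 0 := by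
    rw [fourierTransform_charIndicator hK.isCompact.measurableSet]
    simpa using (measure_real_pos_of_convexBody hK).ne'
  obtain ⟨δ, hδ, hball⟩ := Metric.eventually_nhds_iff.1 (hcont.continuousAt.eventually_ne h0)
  refine radialMoment_ne_zero_of_pos 
    (ENNReal.continuous_ofReal.comp (by fun_prop)).measurable hδ
    (fun x hx => ?_) p a
  have h1 := norm_pos_iff.2 (hball (show dist x 0 < δ by simpa using hx))
  simpa using h1.ne'

theorem norm_fourierTransform_charIndicator_neg (hK : MeasurableSet K)
    (y : EuclideanSpace ℝ (Fin n)) :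
    ‖fourierTransform (charIndicator K) (-y)‖ = ‖fourierTransform (charIndicator K) y‖ := by
  rw [fourierTransform_charIndicator hK, fourierTransform_charIndicator hK, ← Complex.norm_conj,
    ← integral_conj]
  congr 2
  funext x
  rw [← Complex.exp_conj]
  simp

theorem fourierMoment_neg (hK : MeasurableSet K) (p : ℝ) (a : EuclideanSpace ℝ (Fin n)) :
    fourierMoment p K (-a) = fourierMoment p K a := by
  simp only [fourierMoment, radialMoment, smul_neg, norm_fourierTransform_charIndicator_neg hK]

/-- The gauge whose sublevel set, at a suitable level, is the Fourier `p`th mean body. -/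
def fourierGauge (p : ℝ) (K : Set (EuclideanSpace ℝ (Fin n)))
    (a : EuclideanSpace ℝ (Fin n)) : ℝ :=
  (fourierMoment p K a).toReal ^ (-(1 / p))

variable {p : ℝ}

theorem fourierGauge_nonneg (a : EuclideanSpace ℝ (Fin n)) : 0 ≤ fourierGauge p K a :=
  Real.rpow_nonneg ENNReal.toReal_nonneg _

theorem fourierMoment_toReal_pos (hK : IsConvexBody K) (hp : 0 < p) (hp1 : p ≤ 1)
    {a : EuclideanSpace ℝ (Fin n)} (ha : a ≠ 0) : 0 < (fourierMoment p K a).toReal :=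
  ENNReal.toReal_pos (fourierMoment_ne_zero hK p a) (fourierMoment_ne_top hK.isCompact hp hp1 ha)

theorem fourierGauge_pos (hK : IsConvexBody K) (hp : 0 < p) (hp1 : p ≤ 1)
    {a : EuclideanSpace ℝ (Fin n)} (ha : a ≠ 0) : 0 < fourierGauge p K a :=
  Real.rpow_pos_of_pos (fourierMoment_toReal_pos hK hp hp1 ha) _

theorem fourierMoment_eq (hK : IsConvexBody K) (hp : 0 < p) (hp1 : p ≤ 1)
    {a : EuclideanSpace ℝ (Fin n)} (ha : a ≠ 0) :
    fourierMoment p K a = ENNReal.ofReal (fourierGauge p K a ^ (-p)) := by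
  have e : -(1 / p) * -p = 1 := by field_simp
  rw [fourierGauge, ← Real.rpow_mul ENNReal.toReal_nonneg, e, Real.rpow_one,
    ENNReal.ofReal_toReal (fourierMoment_ne_top hK.isCompact hp hp1 ha)]

theorem fourierGauge_smul_of_pos (hp : 0 < p) {c : ℝ} (hc : 0 < c)
    (a : EuclideanSpace ℝ (Fin n)) : fourierGauge p K (c • a) = c * fourierGauge p K a := by
  have e : -p * -(1 / p) = 1 := by field_simp
  rw [fourierGauge, fourierMoment, radialMoment_smul p _ a hc, ENNReal.toReal_mul,
    ENNReal.toReal_ofReal (by positivity), Real.mul_rpow (by positivity) ENNReal.toReal_nonneg,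
    ← Real.rpow_mul hc.le, e, Real.rpow_one, fourierGauge, fourierMoment]

theorem fourierGauge_zero (hp : 0 < p) : fourierGauge p K 0 = 0 := by
  have h := fourierGauge_smul_of_pos (K := K) hp two_pos (0 : EuclideanSpace ℝ (Fin n))
  rw [smul_zero] at h
  linarith

theorem fourierGauge_smul (hK : MeasurableSet K) (hp : 0 < p) (c : ℝ)
    (a : EuclideanSpace ℝ (Fin n)) : fourierGauge p K (c • a) = |c| * fourierGauge p K a := by
  rcases lt_trichotomy c 0 with hc | rfl | hc
  · have : c • a = -((-c) • a) := by simp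
    rw [this, fourierGauge, fourierMoment_neg hK, ← fourierGauge,
      fourierGauge_smul_of_pos hp (by linarith), abs_of_neg hc]
  · simp [fourierGauge_zero hp]
  · rw [fourierGauge_smul_of_pos hp hc, abs_of_pos hc]

theorem lowerSemicontinuousAt_fourierMoment (hK : IsCompact K) (p : ℝ)
    (a : EuclideanSpace ℝ (Fin n)) : LowerSemicontinuousAt (fourierMoment p K) a := by
  have hcont := continuous_fourierTransform_charIndicator hK
  intro z hz
  refine eventually_lt_of_lt_liminf (lt_of_lt_of_le hz ?_)
  refine le_trans (le_of_eq ?_) (lintegral_liminf_le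
    (f := fun x (t : ℝ) => ENNReal.ofReal (t ^ (p - 1)) *
      ENNReal.ofReal (‖fourierTransform (charIndicator K) (t • x)‖ ^ 2)) fun x => by fun_prop)
  refine lintegral_congr fun t => (Tendsto.liminf_eq ?_).symm
  refine ENNReal.Tendsto.const_mul ((ENNReal.continuous_ofReal.comp (by fun_prop)).tendsto a)
    (.inr ENNReal.ofReal_ne_top)

theorem upperSemicontinuousAt_fourierGauge (hK : IsConvexBody K) (hp : 0 < p) (hp1 : p ≤ 1)
    {a : EuclideanSpace ℝ (Fin n)} (ha : a ≠ 0) : UpperSemicontinuousAt (fourierGauge p K) a := by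
  intro z hz
  have hpos := fourierGauge_pos hK hp hp1 ha
  have hz0 : 0 < z := hpos.trans hz
  have h1 : ENNReal.ofReal (z ^ (-p)) < fourierMoment p K a := by
    rw [fourierMoment_eq hK hp hp1 ha, ENNReal.ofReal_lt_ofReal_iff (by positivity)]
    exact Real.rpow_lt_rpow_of_neg hpos hz (by linarith)
  filter_upwards [lowerSemicontinuousAt_fourierMoment hK.isCompact p a _ h1,
    isOpen_ne.mem_nhds ha] with x hx hx0
  have hxpos := fourierGauge_pos hK hp hp1 hx0
  rw [gt_iff_lt, fourierMoment_eq hK hp hp1 hx0, ENNReal.ofReal_lt_ofReal_iff (by positivity)] at hx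
  exact (Real.rpow_lt_rpow_iff_of_neg hz0 hxpos (by linarith)).1 hx

theorem two_mul_rpow_neg_le {m₀ m₁ m₂ q : ℝ} (h₀ : 0 < m₀) (h₁ : 0 < m₁) (h₂ : 0 < m₂)
    (hq : 0 ≤ q) (h : m₁ + m₂ ≤ 2 * m₀) : 2 * m₀ ^ (-q) ≤ m₁ ^ (-q) + m₂ ^ (-q) := by
  have h3 : m₁ * m₂ ≤ m₀ * m₀ := by nlinarith [sq_nonneg (m₁ - m₂)]
  have h4 : m₀ ^ (-q) * m₀ ^ (-q) ≤ m₁ ^ (-q) * m₂ ^ (-q) := by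
    rw [← Real.mul_rpow h₀.le h₀.le, ← Real.mul_rpow h₁.le h₂.le]
    exact Real.rpow_le_rpow_of_nonpos (by positivity) h3 (by linarith)
  have p0 := Real.rpow_pos_of_pos h₀ (-q)
  have p1 := Real.rpow_pos_of_pos h₁ (-q)
  have p2 := Real.rpow_pos_of_pos h₂ (-q)
  refine le_of_sq_le_sq ?_ (by positivity)
  nlinarith [sq_nonneg (m₁ ^ (-q) - m₂ ^ (-q))]

theorem exists_fourierGauge_local_midpoint (hK : IsConvexBody K) (hp : 0 < p) (hp1 : p < 1)
    {a b : EuclideanSpace ℝ (Fin n)} (hab : LinearIndependent ℝ ![a, b]) :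
    ∃ c : ℝ, ∀ h : ℝ, 2 * fourierGauge p K a ≤
      fourierGauge p K ((1 + h * c) • a + h • b) + fourierGauge p K ((1 - h * c) • a - h • b) := by
  obtain ⟨g, hg, C, hC⟩ := exists_planarPotential_eq hK.convex hK.isCompact hK.nonempty_interior hab
  obtain ⟨D, hD⟩ := exists_fourierMoment_eq (n := n) hp hp1
  obtain ⟨c, hc⟩ := hg.exists_planarPotential_add_le hp.le hp1.le
  refine ⟨c, fun h => ?_⟩
  have hne : ∀ s t : ℝ, (s ≠ 0 ∨ t ≠ 0) → s • a + t • b ≠ 0 := by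
    intro s t hst h0
    have := LinearIndependent.pair_iff.1 hab s t h0
    tauto
  have hsub : (1 - h * c) • a - h • b = (1 - h * c) • a + (-h) • b := by
    rw [neg_smul, sub_eq_add_neg]
  have ha : a ≠ 0 := hab.ne_zero 0
  have h1 : (1 + h * c) • a + h • b ≠ 0 := hne _ _ (by
    by_contra hcon; push Not at hcon; simp [hcon.2] at hcon)
  have h2 : (1 - h * c) • a + (-h) • b ≠ 0 := hne _ _ (by
    by_contra hcon; push Not at hcon
    have : h = 0 := by linarith [hcon.2]
    simp [this] at hcon)
  have hM : ∀ s t : ℝ, fourierMoment p K (s • a + t • b) = D * C * planarPotential p g s t :=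
    fun s t => by rw [hD K hK.isCompact, hC, mul_assoc]
  have hMa : fourierMoment p K a = D * C * planarPotential p g 1 0 := by
    rw [← hM, one_smul, zero_smul, add_zero]
  have key : fourierMoment p K ((1 + h * c) • a + h • b) +
      fourierMoment p K ((1 - h * c) • a + (-h) • b) ≤ 2 * fourierMoment p K a := by
    rw [hM, hM, hMa, ← mul_add]
    calc _ ≤ D * C * (2 * planarPotential p g 1 0) := mul_le_mul_right (hc h) _
      _ = _ := by ring
  rw [hsub]
  have t0 := fourierMoment_ne_top hK.isCompact hp hp1.le ha
  have t1 := fourierMoment_ne_top hK.isCompact hp hp1.le h1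
  have t2 := fourierMoment_ne_top hK.isCompact hp hp1.le h2
  refine two_mul_rpow_neg_le (fourierMoment_toReal_pos hK hp hp1.le ha)
    (fourierMoment_toReal_pos hK hp hp1.le h1) (fourierMoment_toReal_pos hK hp hp1.le h2)
    (by positivity) ?_
  have := ENNReal.toReal_mono (ENNReal.mul_ne_top ENNReal.ofNat_ne_top t0) key
  rw [ENNReal.toReal_add t1 t2, ENNReal.toReal_mul] at this
  simpa using this

theorem fourierGauge_add_le_of_lt_one (hK : IsConvexBody K) (hp : 0 < p) (hp1 : p < 1)
    (x y : EuclideanSpace ℝ (Fin n)) :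
    fourierGauge p K (x + y) ≤ fourierGauge p K x + fourierGauge p K y := by
  by_cases hxy : LinearIndependent ℝ ![x, y]
  · exact add_le_of_local_midpoint (fun c x hc => fourierGauge_smul_of_pos hp hc x)
      (fun x hx => upperSemicontinuousAt_fourierGauge hK hp hp1.le hx)
      (fun a b hab => exists_fourierGauge_local_midpoint hK hp hp1 hab) hxy
  · rcases eq_or_ne x 0 with rfl | hx
    · simp [fourierGauge_zero hp]
    · rw [LinearIndependent.pair_iff' hx] at hxy
      push Not at hxy
      obtain ⟨c, rfl⟩ := hxy
      have hm := hK.isCompact.measurableSet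
      have e : x + c • x = (1 + c) • x := by rw [add_smul, one_smul]
      rw [e, fourierGauge_smul hm hp, fourierGauge_smul hm hp, ← one_add_mul]
      refine mul_le_mul_of_nonneg_right ?_ (fourierGauge_nonneg x)
      simpa using abs_add_le 1 c

/-- Dominated convergence; `p = 1` is not covered by the potential formula, since `|u|^(-1)` is not
locally integrable. -/
theorem tendsto_fourierGauge_one (hK : IsConvexBody K) (a : EuclideanSpace ℝ (Fin n)) :
    Tendsto (fun p => fourierGauge p K a) (𝓝[<] 1) (𝓝 (fourierGauge 1 K a)) := by
  have hcont := continuous_fourierTransform_charIndicator hK.isCompact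
  have hmem : ∀ᶠ p in 𝓝[<] (1 : ℝ), p ∈ Ico (1 / 2 : ℝ) 1 :=
    Ico_mem_nhdsLT (by norm_num)
  rcases eq_or_ne a 0 with rfl | ha
  · rw [fourierGauge_zero one_pos]
    refine tendsto_const_nhds.congr' ?_
    filter_upwards [hmem] with p hp
    exact (fourierGauge_zero (by linarith [hp.1])).symm
  have hM : Tendsto (fun p => fourierMoment p K a) (𝓝[<] 1) (𝓝 (fourierMoment 1 K a)) := by
    refine tendsto_lintegral_filter_of_dominated_convergence (fun r : ℝ =>
      (ENNReal.ofReal (r ^ ((1 / 2 : ℝ) - 1)) + ENNReal.ofReal (r ^ ((1 : ℝ) - 1))) *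
        ENNReal.ofReal (‖fourierTransform (charIndicator K) (r • a)‖ ^ 2)) ?_ ?_ ?_ ?_
    · exact Eventually.of_forall fun p => by fun_prop
    · filter_upwards [hmem] with p hp
      filter_upwards [self_mem_ae_restrict measurableSet_Ioi] with r hr
      have := rpow_sub_one_le hp.1 hp.2.le hr
      rw [sub_self, Real.rpow_zero, ENNReal.ofReal_one]
      gcongr
    · simp only [add_mul]
      rw [lintegral_add_left (by fun_prop)]
      exact ENNReal.add_ne_top.2
        ⟨fourierMoment_ne_top hK.isCompact (by norm_num) (by norm_num) ha,
          fourierMoment_ne_top hK.isCompact one_pos le_rfl ha⟩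
    · filter_upwards [self_mem_ae_restrict measurableSet_Ioi] with r hr
      have hr : 0 < r := hr
      refine ENNReal.Tendsto.mul_const ?_ (.inr ENNReal.ofReal_ne_top)
      refine ENNReal.tendsto_ofReal (Tendsto.mono_left ?_ nhdsWithin_le_nhds)
      have : Continuous fun p : ℝ => r ^ (p - 1) :=
        Continuous.rpow continuous_const (by fun_prop) fun _ => .inl hr.ne'
      exact this.tendsto 1
  have hne := fourierMoment_ne_top hK.isCompact one_pos le_rfl ha
  refine Tendsto.rpow ((ENNReal.tendsto_toReal hne).comp hM) ?_
    (.inl (fourierMoment_toReal_pos hK one_pos le_rfl ha).ne')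
  refine Tendsto.mono_left (ContinuousAt.tendsto ?_) nhdsWithin_le_nhds
  exact (continuousAt_const.div continuousAt_id one_ne_zero).neg

theorem fourierGauge_add_le (hK : IsConvexBody K) (hp : 0 < p) (hp1 : p ≤ 1)
    (x y : EuclideanSpace ℝ (Fin n)) :
    fourierGauge p K (x + y) ≤ fourierGauge p K x + fourierGauge p K y := by
  rcases hp1.lt_or_eq with h | rfl
  · exact fourierGauge_add_le_of_lt_one hK hp h x y
  · refine le_of_tendsto_of_tendsto (tendsto_fourierGauge_one hK (x + y))
      ((tendsto_fourierGauge_one hK x).add (tendsto_fourierGauge_one hK y)) ?_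
    have hmem : ∀ᶠ p in 𝓝[<] (1 : ℝ), p ∈ Ioo (0 : ℝ) 1 := Ioo_mem_nhdsLT one_pos
    filter_upwards [hmem] with p hp using fourierGauge_add_le_of_lt_one hK hp.1 hp.2 x y

theorem convexOn_fourierGauge (hK : IsConvexBody K) (hp : 0 < p) (hp1 : p ≤ 1) :
    ConvexOn ℝ univ (fourierGauge p K) := by
  refine convexOn_iff_forall_pos.2 ⟨convex_univ, fun x _ y _ a b ha hb _ => ?_⟩
  refine (fourierGauge_add_le hK hp hp1 _ _).trans (le_of_eq ?_)
  rw [fourierGauge_smul_of_pos hp ha, fourierGauge_smul_of_pos hp hb, smul_eq_mul, smul_eq_mul]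

/-- At the origin both sides hold trivially, whatever the value of the radial function. -/
theorem mem_fourierMeanBody_iff (hK : IsConvexBody K) (hp : 0 < p) (hp1 : p ≤ 1)
    (x : EuclideanSpace ℝ (Fin n)) : x ∈ fourierMeanBody p K ↔
      fourierGauge p K x ≤ (p / volume.real K) ^ (1 / p) := by
  have hV := measure_real_pos_of_convexBody hK
  rcases eq_or_ne x 0 with rfl | hx
  · refine iff_of_true (fun h => absurd rfl h) ?_
    rw [fourierGauge_zero hp]
    positivity
  have hx0 : 0 < ‖x‖ := norm_pos_iff.2 hx
  have hg := fourierGauge_pos hK hp hp1 hx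
  have hvol : volume K = ENNReal.ofReal (volume.real K) :=
    (ENNReal.ofReal_toReal hK.isCompact.measure_ne_top).symm
  have hlin : ∫⁻ r in Ioi (0 : ℝ), ENNReal.ofReal
      (‖fourierTransform (charIndicator K) (r • ‖x‖⁻¹ • x)‖ ^ 2 * r ^ (p - 1)) =
      ENNReal.ofReal (‖x‖ ^ p) * fourierMoment p K x := by
    have h := radialMoment_smul p
      (fun y => ENNReal.ofReal (‖fourierTransform (charIndicator K) y‖ ^ 2)) x
      (inv_pos.2 hx0)
    rw [Real.rpow_neg (by positivity), Real.inv_rpow hx0.le, inv_inv] at h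
    rw [fourierMoment, ← h, radialMoment]
    refine setLIntegral_congr_fun measurableSet_Ioi fun r hr => ?_
    have hr : 0 < r := hr
    rw [mul_comm, ENNReal.ofReal_mul (by positivity)]
  have hrad : fourierMeanRadial p K (‖x‖⁻¹ • x) =
      ENNReal.ofReal ((p / volume.real K) ^ (1 / p) * (‖x‖ / fourierGauge p K x)) := by
    rw [fourierMeanRadial, hlin, fourierMoment_eq hK hp hp1 hx, hvol,
      ← ENNReal.ofReal_div_of_pos hV, ← ENNReal.ofReal_mul (by positivity),
      ← ENNReal.ofReal_mul (by positivity),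
      ENNReal.ofReal_rpow_of_pos (by positivity)]
    congr 1
    have e : p * (1 / p) = 1 := by field_simp
    have e' : -p * (1 / p) = -1 := by field_simp
    rw [Real.mul_rpow (by positivity) (by positivity),
      Real.mul_rpow (by positivity) (by positivity), ← Real.rpow_mul hx0.le,
      ← Real.rpow_mul hg.le, e, e', Real.rpow_one, Real.rpow_neg_one, div_eq_mul_inv ‖x‖]
  have hiff : x ∈ fourierMeanBody p K ↔
      ENNReal.ofReal ‖x‖ ≤ fourierMeanRadial p K (‖x‖⁻¹ • x) :=
    ⟨fun h => h hx, fun h _ => h⟩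
  rw [hiff, hrad, ENNReal.ofReal_le_ofReal_iff (by positivity), mul_div_assoc',
    le_div_iff₀ hg, mul_comm, mul_le_mul_iff_of_pos_right hx0]

end FourierGauge

/-! ### Convexity of the Fourier mean body -/

theorem theoremt (n : ℕ) (K : Set (EuclideanSpace ℝ (Fin n))) (hK : IsConvexBody K)
    (p : ℝ) (hp0 : 0 < p) (hp1 : p ≤ 1) :
    IsConvexBody (fourierMeanBody p K) ∧ IsOriginSymmetric (fourierMeanBody p K) := by
  set C := (p / volume.real K) ^ (1 / p) with hC
  have hCpos : 0 < C := by
    have := measure_real_pos_of_convexBody hK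
    positivity
  have hset : fourierMeanBody p K = {x | fourierGauge p K x ≤ C} :=
    Set.ext fun x => mem_fourierMeanBody_iff hK hp0 hp1 x
  have hconv := convexOn_fourierGauge hK hp0 hp1
  have hcont : Continuous (fourierGauge p K) := hconv.locallyLipschitz.continuous
  have hm := hK.isCompact.measurableSet
  rw [hset]
  refine ⟨⟨?_, ?_, ?_⟩, ?_⟩
  · simpa using hconv.convex_le C
  · refine Metric.isCompact_of_isClosed_isBounded (isClosed_le hcont continuous_const) ?_
    rcases (Metric.sphere (0 : EuclideanSpace ℝ (Fin n)) 1).eq_empty_or_nonempty with he | hne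
    · refine (Set.Subsingleton.finite (s := univ) ?_).isBounded.subset (subset_univ _)
      have hz : ∀ x : EuclideanSpace ℝ (Fin n), x = 0 := by
        intro x
        by_contra hx
        have : ‖x‖⁻¹ • x ∈ Metric.sphere (0 : EuclideanSpace ℝ (Fin n)) 1 := by
          rw [mem_sphere_zero_iff_norm, norm_smul, norm_inv, norm_norm,
            inv_mul_cancel₀ (norm_ne_zero_iff.2 hx)]
        rw [he] at this
        exact this
      exact fun x _ y _ => (hz x).trans (hz y).symm
    · obtain ⟨θ, hθ, hmin⟩ := (isCompact_sphere _ _).exists_isMinOn hne hcont.continuousOn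
      have hθ0 : θ ≠ 0 := by
        rintro rfl
        simp at hθ
      have hθpos := fourierGauge_pos hK hp0 hp1 hθ0
      refine (Metric.isBounded_closedBall (x := 0)
        (r := C / fourierGauge p K θ)).subset fun x hx => ?_
      have hx : fourierGauge p K x ≤ C := hx
      rw [mem_closedBall_zero_iff, le_div_iff₀ hθpos]
      refine le_trans ?_ hx
      rcases eq_or_ne x 0 with rfl | hx0
      · simp [fourierGauge_zero hp0]
      · have hxn := norm_pos_iff.2 hx0
        have hs : ‖x‖⁻¹ • x ∈ Metric.sphere (0 : EuclideanSpace ℝ (Fin n)) 1 := by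
          rw [mem_sphere_zero_iff_norm, norm_smul, norm_inv, norm_norm,
            inv_mul_cancel₀ hxn.ne']
        have h1 : fourierGauge p K θ ≤ fourierGauge p K (‖x‖⁻¹ • x) := hmin hs
        rw [fourierGauge_smul_of_pos hp0 (inv_pos.2 hxn), inv_mul_eq_div,
          le_div_iff₀ hxn] at h1
        linarith
  · refine ⟨0, mem_interior.2 ⟨{x | fourierGauge p K x < C}, 
      fun x (hx : fourierGauge p K x < C) => (hx.le : fourierGauge p K x ≤ C),
      isOpen_lt hcont continuous_const, ?_⟩⟩
    simpa [fourierGauge_zero hp0] using hCpos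
  · ext x
    have : fourierGauge p K (-x) = fourierGauge p K x := by
      rw [fourierGauge, fourierMoment_neg hm, fourierGauge]
    simp only [mem_ofPred_eq, this]

end
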